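/- Let $\Lambda$ be an artin algebra (an algebra over a commutative artinian ring $R$ that is finitely generated as an $R$-module), and let $\mathrm{mod}\,\Lambda$ be the abelian category of finitely generated right $\Lambda$-modules. For a class $\mathcal U$ of modules in $\mathrm{mod}\,\Lambda$, let $\mathrm{add}\,\mathcal U$ be the class of all direct summands of finite direct sums of modules in $\mathcal U$. For classes $\mathcal U,\mathcal V$ let $\mathcal U\diamond\mathcal V$ be $\mathrm{add}$ of the class of all $A$ for which there is an exact sequence $0\to U\to A\to V\to 0$ with $U\in\mathcal U$, $V\in\mathcal V$. For $T\in\mathrm{mod}\,\Lambda$ put $\langle T\rangle_0=0$, $\langle T\rangle_1=\mathrm{add}\{T\}$ and $\langle T\rangle_n=\langle T\rangle_1\diamond\langle T\rangle_{n-1}$ for $n\ge 2$. For a class $\mathcal X$ of modules in $\mathrm{mod}\,\Lambda$ put (with $\inf\emptyset=+\infty$) $$\mathrm{size}\,\mathcal X=\inf\{n\ge 0\mid \mathcal X\subseteq\langle T\rangle_{n+1}\text{ for some }T\in\mathrm{mod}\,\Lambda\},$$ and let the extension dimension be $$\dim\mathrm{mod}\,\Lambda=\inf\{n\ge 0\mid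 \mathrm{mod}\,\Lambda=\langle T\rangle_{n+1}\text{ for some }T\in\mathrm{mod}\,\Lambda\}.$$ Let $\mathcal P^{<\infty}$ be the class of modules in $\mathrm{mod}\,\Lambda$ of finite projective dimension (zero modules included), and let $\mathrm{findim}\,\Lambda=\sup\{\mathrm{pd}\,M\mid M\in\mathcal P^{<\infty}\}$ be the finitistic dimension. Let $\Omega^0(M)=M$, let $\Omega^1(M)$ be the kernel of a projective cover (a right minimal epimorphism from a projective module) of $M$, let $\Omega^{n+1}(M)=\Omega^1(\Omega^n(M))$, and let $\Omega^n(\mathcal P^{<\infty})$ be the class of all modules isomorphic to $\Omega^n(M)$ for some $M\in\mathcal P^{<\infty}$. (a) The following are equivalent: (1) $\mathrm{findim}\,\Lambda<\infty$; (2) there is an integer $n\ge 0$ such that $\mathrm{size}\,\Omega^n(\mathcal P^{<\infty})\le 1$. (b) If $\dim\mathrm{mod}\,\Lambda\le 1$, then $\mathrm{findim}\,\Lambda<\infty$. -/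

import Mathlib

open CategoryTheory CategoryTheory.Limits

universe v u

namespace ExtDim

section Abelian

variable {C : Type u} [Category.{v} C] [Abelian C]

attribute [local instance] Abelian.hasFiniteBiproducts

/-- `add U`: the direct summands of finite direct sums of objects in the class `U`. -/
def add (U : ObjectProperty C) : ObjectProperty C := fun X =>
  ∃ (k : ℕ) (F : Fin k → C) (Y : C), (∀ i, U (F i)) ∧ Nonempty (X ⊞ Y ≅ ⨁ F)

/-- `U ⋄ V`: the additive closure of the class of all objects `A` which are the middle term of a
short exact sequence `0 ⟶ U₁ ⟶ A ⟶ V₁ ⟶ 0` with `U₁` in `U` and `V₁` in `V`. -/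
def diamond (U V : ObjectProperty C) : ObjectProperty C :=
  add fun A => ∃ (U₁ V₁ : C) (f : U₁ ⟶ A) (g : A ⟶ V₁) (w : f ≫ g = 0),
    U U₁ ∧ V V₁ ∧ (ShortComplex.mk f g w).ShortExact

/-- `⟨U⟩ₙ`: zero objects for `n = 0`, then `⟨U⟩₁ = add U` and `⟨U⟩ₙ = ⟨U⟩₁ ⋄ ⟨U⟩ₙ₋₁` for
`n ≥ 2`. -/
def extPower (U : ObjectProperty C) : ℕ → ObjectProperty C
  | 0 => fun X => IsZero X
  | 1 => add U
  | n + 2 => diamond (add U) (extPower U (n + 1))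

/-- `⟨T⟩ₙ` for a single object `T`. -/
def extPowerObj (T : C) (n : ℕ) : ObjectProperty C :=
  extPower (fun X => X = T) n

/-- `size 𝒳 = inf {n ≥ 0 | 𝒳 ⊆ ⟨T⟩ₙ₊₁ for some object T}`, with `inf ∅ = ∞`. -/
noncomputable def size (𝒳 : ObjectProperty C) : ℕ∞ :=
  sInf {a : ℕ∞ | ∃ (n : ℕ) (T : C), a = (n : ℕ∞) ∧ ∀ X, 𝒳 X → extPowerObj T (n + 1) X}

/-- `rank 𝒳 = inf {n ≥ 0 | 𝒳 = ⟨T⟩ₙ₊₁ for some object T}`, with `inf ∅ = ∞`. -/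
noncomputable def rank (𝒳 : ObjectProperty C) : ℕ∞ :=
  sInf {a : ℕ∞ | ∃ (n : ℕ) (T : C), a = (n : ℕ∞) ∧ ∀ X, 𝒳 X ↔ extPowerObj T (n + 1) X}

variable (C) in
/-- The extension dimension of an abelian category: the rank of the whole category. -/
noncomputable def extensionDimension : ℕ∞ :=
  rank (fun _ : C => True)

/-- A morphism `f : X ⟶ Y` is right minimal if every endomorphism `g` of `X` with `g ≫ f = f` is
an isomorphism. -/
def IsRightMinimal {X Y : C} (f : X ⟶ Y) : Prop :=
  ∀ g : X ⟶ X, g ≫ f = f → IsIso g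

/-- `K` is (a representative of the isomorphism class) `Ω¹(X)`: the kernel of a right minimal
epimorphism from a projective object onto `X`. -/
def IsSyzygy (K X : C) : Prop :=
  ∃ (P : C) (i : K ⟶ P) (p : P ⟶ X) (w : i ≫ p = 0),
    Projective P ∧ IsRightMinimal p ∧ (ShortComplex.mk i p w).ShortExact

/-- `K ≅ Ωⁿ(X)`, where `Ω⁰(X) = X` and `Ωⁿ⁺¹(X) = Ω¹(Ωⁿ(X))`. -/
def IsNthSyzygy : ℕ → C → C → Prop
  | 0, K, X => Nonempty (K ≅ X)
  | n + 1, K, X => ∃ L : C, IsNthSyzygy n L X ∧ IsSyzygy K L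

/-- `Ωⁿ(𝒳) = {Ωⁿ(M) | M ∈ 𝒳}`, as a class closed under isomorphisms. -/
def syzygyClass (n : ℕ) (𝒳 : ObjectProperty C) : ObjectProperty C := fun K =>
  ∃ M : C, 𝒳 M ∧ IsNthSyzygy n K M

variable (C) in
/-- `𝒫^{<∞}`: the objects of finite projective dimension (`⊥ = -∞` is the projective dimension of
zero objects). -/
def finiteProjDim : ObjectProperty C := fun M => projectiveDimension M < ⊤

end Abelian

section ArtinAlgebra

/-- `Λ` is an artin algebra: it is an algebra over a commutative artinian ring `R` and finitely
generated as an `R`-module. (Replacing `R` by its image in the centre of `Λ`, one may always take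
`R` in the universe of `Λ`.) -/
class IsArtinAlgebra (Λ : Type u) [Ring Λ] : Prop where
  exists_base : ∃ (R : Type u) (_ : CommRing R) (_ : Algebra R Λ),
    IsArtinianRing R ∧ Module.Finite R Λ

/-- An artin algebra is right noetherian, so that its finitely generated right modules form an
abelian category. -/
instance IsArtinAlgebra.isNoetherianRing_op (Λ : Type u) [Ring Λ] [h : IsArtinAlgebra Λ] :
    IsNoetherianRing Λᵐᵒᵖ := by
  obtain ⟨R, _, _, _, _⟩ := h.exists_base
  have : Module.Finite R Λᵐᵒᵖ := Module.Finite.equiv (MulOpposite.opLinearEquiv R (M := Λ))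
  have : IsNoetherian R Λᵐᵒᵖ := inferInstance
  exact isNoetherian_of_tower R this

/-- `mod Λ`: the category of finitely generated right `Λ`-modules, that is, of finitely generated
left modules over the opposite ring. -/
abbrev RMod (Λ : Type u) [Ring Λ] := FGModuleCat.{u} Λᵐᵒᵖ

/-- The finitistic dimension `sup {pd M | M ∈ mod Λ, pd M < ∞}`. -/
noncomputable def findim (Λ : Type u) [Ring Λ] [IsArtinAlgebra Λ] : WithBot ℕ∞ :=
  sSup {d | ∃ M : RMod Λ, finiteProjDim (RMod Λ) M ∧ d = projectiveDimension M}

end ArtinAlgebra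

end ExtDim

/-! If `findim Λ` is at most `d`, every `d`-th syzygy of a module of finite projective dimension is
projective, hence lies in `add Λ`, and the size is 0. Part (b) is the implication (2) ⇒ (1) for `n =
0`, since the size of any class is at most the extension dimension.

The substance is `exists_bound_of_extension`: if `X` is a summand, of finite projective dimension,
of an extension `W` of `V` by `U` with `U, V` in `add T`, then `pd X` is bounded in terms of `T`
alone. Let `e` be the idempotent of `W` with image `X`. The map `φ : U ⟶ W ⟶ W ⟶ V` given by `e`
factors through `X`, so it kills `Ext^j` for large `j`; as `End T` is noetherian, a uniform `N`
suffices (`exists_extVanish_bound`). Passing to syzygies `N` times makes `φ` kill `Ext¹`, so that it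
lifts to a projective `Q` covering `V`. Then `e` lifts to an idempotent of the middle term of `syz V
⟶ U ⊞ Q ⟶ W`, and `X` is the cokernel of a monomorphism between objects of `add (T ⊞ syz T ⊞ gen
C)`.

Such cokernels are controlled by `igusa_todorov_bound`. For `A ⟶ B ⟶ X` with `pd X` finite, `A` and
`B` have stably isomorphic high syzygies; finite generation over `ℤ` bounds the number of syzygies
needed, and `exists_bound_of_stableIso` settles the case where `A` and `B` are already stably
isomorphic. -/

open scoped ZeroObject

universe w

namespace ExtDim

/-! ### Short exact sequences, the horseshoe lemma and additive closures. -/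

section Basics

variable {C : Type u} [Category.{v} C] [Abelian C]

/-- `0 ⟶ A ⟶ B ⟶ X ⟶ 0` is a short exact sequence. -/
def SES {A B X : C} (f : A ⟶ B) (g : B ⟶ X) : Prop :=
  ∃ w : f ≫ g = 0, (ShortComplex.mk f g w).ShortExact

namespace SES

variable {A B X : C} {f : A ⟶ B} {g : B ⟶ X}

lemma w (h : SES f g) : f ≫ g = 0 := h.1

lemma mono (h : SES f g) : Mono f := h.2.mono_f

lemma epi (h : SES f g) : Epi g := h.2.epi_g

lemma lift (h : SES f g) {Z : C} (x : Z ⟶ B) (hx : x ≫ g = 0) : ∃ y : Z ⟶ A, y ≫ f = x := by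
  have := h.mono
  exact ⟨h.2.exact.lift x hx, h.2.exact.lift_f x hx⟩

lemma desc (h : SES f g) {Z : C} (x : B ⟶ Z) (hx : f ≫ x = 0) : ∃ y : X ⟶ Z, g ≫ y = x := by
  have := h.epi
  exact ⟨h.2.exact.desc x hx, h.2.exact.g_desc x hx⟩

lemma mk' (hf : Mono f) (hg : Epi g) (w : f ≫ g = 0)
    (hl : ∀ (Z : C) (x : Z ⟶ B), x ≫ g = 0 → ∃ y : Z ⟶ A, y ≫ f = x) : SES f g := by
  refine ⟨w, ?_⟩
  have : (ShortComplex.mk f g w).Exact := by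
    rw [ShortComplex.exact_iff_exact_up_to_refinements]
    intro Z x hx
    obtain ⟨y, hy⟩ := hl Z x hx
    exact ⟨Z, 𝟙 Z, inferInstance, y, by simpa using hy.symm⟩
  exact { exact := this, mono_f := hf, epi_g := hg }

lemma ofKernel (g : B ⟶ X) [Epi g] : SES (kernel.ι g) g :=
  mk' inferInstance inferInstance (kernel.condition g)
    fun _ x hx => ⟨kernel.lift g x hx, kernel.lift_ι g x hx⟩

lemma ofCokernel (f : A ⟶ B) [Mono f] : SES f (cokernel.π f) :=
  ⟨cokernel.condition f, { exact := ShortComplex.exact_cokernel f }⟩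

lemma iso_of_retraction (h : SES f g) (s : X ⟶ B) (hs : s ≫ g = 𝟙 X) :
    Nonempty (B ≅ A ⊞ X) := by
  have := h.mono
  exact ⟨(ShortComplex.Splitting.ofExactOfSection _ h.2.exact s hs this).isoBinaryBiproduct⟩

lemma iso_of_projective (h : SES f g) [Projective X] : Nonempty (B ≅ A ⊞ X) := by
  have := h.epi
  exact h.iso_of_retraction (Projective.factorThru (𝟙 X) g) (by simp)

lemma biprod (h : SES f g) {A' B' X' : C} {f' : A' ⟶ B'} {g' : B' ⟶ X'} (h' : SES f' g') :
    SES (biprod.map f f') (biprod.map g g') := by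
  have := h.mono
  have := h.epi
  have := h'.mono
  have := h'.epi
  refine mk' inferInstance inferInstance ?_ ?_
  · ext <;> simp [h.w, h'.w]
  · intro Z x hx
    obtain ⟨y, hy⟩ := h.lift (x ≫ biprod.fst) (by simpa using hx =≫ biprod.fst)
    obtain ⟨y', hy'⟩ := h'.lift (x ≫ biprod.snd) (by simpa using hx =≫ biprod.snd)
    exact ⟨biprod.lift y y', by ext <;> simp [hy, hy']⟩

lemma id_zero (X : C) : SES (𝟙 X) (0 : X ⟶ (0 : C)) :=
  mk' inferInstance ⟨fun _ _ _ => (isZero_zero C).eq_of_src _ _⟩ (by simp) fun _ x _ => ⟨x, by simp⟩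

lemma comp_iso (h : SES f g) {B' X' : C} (e : B' ≅ B) (e' : X ≅ X') :
    SES (f ≫ e.inv) (e.hom ≫ g ≫ e'.hom) := by
  have := h.mono
  have := h.epi
  refine mk' inferInstance inferInstance (by simp [reassoc_of% h.w]) fun Z x hx => ?_
  obtain ⟨y, hy⟩ := h.lift (x ≫ e.hom) (by
    rw [← cancel_mono e'.hom]
    simpa using hx)
  exact ⟨y, by simp [reassoc_of% hy]⟩

end SES

/-- A short exact sequence of sequences `K ⟶ P ⟶ X`: the horseshoe lemma. -/
lemma horseshoe {U W V KU KV P Q : C} {i : U ⟶ W} {p : W ⟶ V} (h : SES i p)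
    {a : KU ⟶ P} {b : P ⟶ U} (hU : SES a b) {c : KV ⟶ Q} {d : Q ⟶ V} (hV : SES c d)
    [Projective Q] :
    ∃ (KW : C) (k : KW ⟶ P ⊞ Q) (l : P ⊞ Q ⟶ W) (i' : KU ⟶ KW) (p' : KW ⟶ KV),
      SES k l ∧ SES i' p' ∧ i' ≫ k = a ≫ biprod.inl ∧ p' ≫ c = k ≫ biprod.snd ∧
      biprod.inl ≫ l = b ≫ i ∧ l ≫ p = biprod.snd ≫ d := by
  have := h.mono
  have := h.epi
  have := hU.mono
  have := hU.epi
  have := hV.mono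
  have := hV.epi
  let q : Q ⟶ W := Projective.factorThru d p
  have hq : q ≫ p = d := by simp [q]
  let l : P ⊞ Q ⟶ W := biprod.desc (b ≫ i) q
  have hlp : l ≫ p = biprod.snd ≫ d := by ext <;> simp [l, h.w, hq]
  have hl : Epi l := by
    refine Preadditive.epi_of_cancel_zero _ fun {Z} x hx => ?_
    have h1 : i ≫ x = 0 := by
      have := biprod.inl ≫= hx
      simp only [l, biprod.inl_desc_assoc, Category.assoc, comp_zero] at this
      exact (cancel_epi b).1 (by simpa using this)
    obtain ⟨y, rfl⟩ := h.desc x h1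
    have h2 := biprod.inr ≫= hx
    simp only [l, biprod.inr_desc_assoc, reassoc_of% hq, comp_zero] at h2
    have : y = 0 := (cancel_epi d).1 (by simpa using h2)
    simp [this]
  have hk := SES.ofKernel l
  obtain ⟨i', hi'⟩ := hk.lift (a ≫ biprod.inl) (by simp [l, reassoc_of% hU.w])
  obtain ⟨p', hp'⟩ := hV.lift (kernel.ι l ≫ biprod.snd) (by
    rw [Category.assoc, ← hlp, kernel.condition_assoc, zero_comp])
  have hmono : Mono i' := by
    have : Mono (i' ≫ kernel.ι l) := by rw [hi']; infer_instance
    exact mono_of_mono i' (kernel.ι l)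
  have hepi : Epi p' := by
    rw [epi_iff_surjective_up_to_refinements]
    intro Z y
    obtain ⟨u, hu⟩ := h.lift (y ≫ c ≫ q) (by simp [hq, hV.w])
    obtain ⟨Z', π, hπ, z, hz⟩ := surjective_up_to_refinements_of_epi b (-u)
    refine ⟨Z', π, hπ, kernel.lift l (biprod.lift z (π ≫ y ≫ c)) ?_, ?_⟩
    · simp only [l, biprod.lift_desc, Category.assoc, ← reassoc_of% hz, ← hu]
      simp
    · rw [← cancel_mono c]
      simp [hp']
  refine ⟨kernel l, kernel.ι l, l, i', p', hk, SES.mk' hmono hepi ?_ ?_, hi', hp', by simp [l], hlp⟩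
  · rw [← cancel_mono c]
    simp [hp', reassoc_of% hi']
  · intro Z x hx
    have h1 : x ≫ kernel.ι l ≫ biprod.snd = 0 := by rw [← hp', reassoc_of% hx, zero_comp]
    obtain ⟨y, hy⟩ := hU.lift (x ≫ kernel.ι l ≫ biprod.fst) (by
      rw [← cancel_mono i]
      have h3 : biprod.fst ≫ b ≫ i + biprod.snd ≫ q = l := by ext <;> simp [l]
      have h2 : x ≫ kernel.ι l ≫ (biprod.fst ≫ b ≫ i + biprod.snd ≫ q) = 0 := by
        rw [h3, kernel.condition, comp_zero]
      simp only [Preadditive.comp_add] at h2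
      rw [reassoc_of% h1, zero_comp, add_zero] at h2
      simpa using h2)
    refine ⟨y, ?_⟩
    rw [← cancel_mono (kernel.ι l)]
    ext
    · simp [hi', hy]
    · simp [hi', h1]

/-- `X` is a direct summand of a finite direct sum of copies of `T`. -/
def AddGen (T X : C) : Prop :=
  ∃ (ι : Type) (_ : Fintype ι) (s : ι → (X ⟶ T)) (t : ι → (T ⟶ X)), ∑ i, s i ≫ t i = 𝟙 X

namespace AddGen

variable {T X Y : C}

lemma of_retract (h : AddGen T Y) (r : Retract X Y) : AddGen T X := by
  obtain ⟨ι, _, s, t, hst⟩ := h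
  refine ⟨ι, ‹_›, fun i => r.i ≫ s i, fun i => t i ≫ r.r, ?_⟩
  have := r.i ≫= hst =≫ r.r
  simpa [Preadditive.comp_sum, Preadditive.sum_comp] using this

lemma self (T : C) : AddGen T T := ⟨Unit, inferInstance, fun _ => 𝟙 T, fun _ => 𝟙 T, by simp⟩

lemma of_isZero (h : IsZero X) : AddGen T X :=
  ⟨Empty, inferInstance, Empty.elim, Empty.elim, h.eq_of_src _ _⟩

lemma biprod (hX : AddGen T X) (hY : AddGen T Y) : AddGen T (X ⊞ Y) := by
  obtain ⟨ι, _, s, t, hst⟩ := hX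
  obtain ⟨κ, _, s', t', hst'⟩ := hY
  refine ⟨ι ⊕ κ, inferInstance, Sum.elim (fun i => biprod.fst ≫ s i) (fun i => biprod.snd ≫ s' i),
    Sum.elim (fun i => t i ≫ biprod.inl) (fun i => t' i ≫ biprod.inr), ?_⟩
  have h1 : ∀ i, (biprod.fst ≫ s i) ≫ t i ≫ biprod.inl =
      (biprod.fst : X ⊞ Y ⟶ X) ≫ (s i ≫ t i) ≫ (biprod.inl : X ⟶ X ⊞ Y) := by simp
  have h2 : ∀ i, (biprod.snd ≫ s' i) ≫ t' i ≫ biprod.inr =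
      (biprod.snd : X ⊞ Y ⟶ Y) ≫ (s' i ≫ t' i) ≫ (biprod.inr : Y ⟶ X ⊞ Y) := by simp
  simp only [Fintype.sum_sum_type, Sum.elim_inl, Sum.elim_inr, h1, h2]
  rw [← Preadditive.comp_sum, ← Preadditive.comp_sum, ← Preadditive.sum_comp,
    ← Preadditive.sum_comp, hst, hst']
  simp [biprod.total]

lemma trans {T' : C} (hT : AddGen T' T) (hX : AddGen T X) : AddGen T' X := by
  obtain ⟨ι, _, s, t, hst⟩ := hX
  obtain ⟨κ, _, s', t', hst'⟩ := hT
  refine ⟨ι × κ, inferInstance, fun x => s x.1 ≫ s' x.2, fun x => t' x.2 ≫ t x.1, ?_⟩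
  rw [Fintype.sum_prod_type, ← hst]
  refine Finset.sum_congr rfl fun i _ => ?_
  have := s i ≫= hst' =≫ t i
  simpa [Preadditive.comp_sum, Preadditive.sum_comp] using this

lemma inl (hX : AddGen T X) (Y : C) : AddGen (T ⊞ Y) X :=
  trans (of_retract (self _) ⟨biprod.inl, biprod.fst, by simp⟩) hX

lemma inr (hX : AddGen T X) (Y : C) : AddGen (Y ⊞ T) X :=
  trans (of_retract (self _) ⟨biprod.inr, biprod.snd, by simp⟩) hX

lemma of_iso (hX : AddGen T X) (e : Y ≅ X) : AddGen T Y := hX.of_retract e.retract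

lemma projective (hX : AddGen T X) [Projective T] : Projective X := by
  obtain ⟨ι, _, s, t, hst⟩ := hX
  refine ⟨fun {E Z} f g _ => ⟨∑ i, s i ≫ Projective.factorThru (t i ≫ f) g, ?_⟩⟩
  simp only [Preadditive.sum_comp, Category.assoc, Projective.factorThru_comp]
  simp only [← Category.assoc, ← Preadditive.sum_comp, hst, Category.id_comp]

lemma biproduct {n : ℕ} {F : Fin n → C} (h : ∀ i, AddGen T (F i))
    [HasBiproduct F] : AddGen T (⨁ F) := by
  choose ι hι s t hst using h
  refine ⟨Σ i, ι i, inferInstance, fun x => biproduct.π F x.1 ≫ s x.1 x.2,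
    fun x => t x.1 x.2 ≫ biproduct.ι F x.1, ?_⟩
  rw [Fintype.sum_sigma, ← biproduct.total]
  refine Finset.sum_congr rfl fun i _ => ?_
  have := biproduct.π F i ≫= hst i =≫ biproduct.ι F i
  simpa [Preadditive.comp_sum, Preadditive.sum_comp] using this

end AddGen

open Abelian

/-! ### Morphisms that act as zero on high Ext groups. -/

section ExtVanish

variable [HasExt.{w} C]

/-- The map induced by `φ` on `Ext^j(-, Z)` is zero for all `j ≥ n` and all `Z`. -/
def ExtVanish (n : ℕ) {X Y : C} (φ : X ⟶ Y) : Prop :=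
  ∀ (j : ℕ), n ≤ j → ∀ (Z : C) (α : Ext.{w} Y Z j), (Ext.mk₀ φ).comp α (zero_add j) = 0

namespace ExtVanish

variable {n : ℕ} {X Y : C} {φ ψ : X ⟶ Y}

lemma mono (h : ExtVanish.{v, u, w} n φ) {m : ℕ} (hm : n ≤ m) : ExtVanish.{v, u, w} m φ :=
  fun j hj => h j (hm.trans hj)

lemma add (h : ExtVanish.{v, u, w} n φ) (h' : ExtVanish.{v, u, w} n ψ) : ExtVanish.{v, u, w} n (φ + ψ) := by
  intro j hj Z α
  rw [Ext.mk₀_add, Ext.add_comp, h j hj, h' j hj, add_zero]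

lemma zero : ExtVanish.{v, u, w} n (0 : X ⟶ Y) := by
  intro j hj Z α
  rw [Ext.mk₀_zero, Ext.zero_comp]

lemma sum {ι : Type} (s : Finset ι) {φ : ι → (X ⟶ Y)} (h : ∀ i ∈ s, ExtVanish.{v, u, w} n (φ i)) :
    ExtVanish.{v, u, w} n (∑ i ∈ s, φ i) :=
  Finset.sum_induction _ _ (fun _ _ => add) zero h

lemma precomp (h : ExtVanish.{v, u, w} n φ) {X' : C} (f : X' ⟶ X) : ExtVanish.{v, u, w} n (f ≫ φ) := by
  intro j hj Z α
  rw [← Ext.mk₀_comp_mk₀_assoc, h j hj, Ext.comp_zero]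

lemma postcomp (h : ExtVanish.{v, u, w} n φ) {Y' : C} (f : Y ⟶ Y') : ExtVanish.{v, u, w} n (φ ≫ f) := by
  intro j hj Z α
  rw [← Ext.mk₀_comp_mk₀_assoc, h j hj]

lemma of_factor {Z : C} (hZ : HasProjectiveDimensionLT Z n) (f : X ⟶ Z) (g : Z ⟶ Y) :
    ExtVanish.{v, u, w} n (f ≫ g) := by
  intro j hj W α
  rw [← Ext.mk₀_comp_mk₀_assoc,
    ((Ext.mk₀ g).comp α (zero_add j)).eq_zero_of_hasProjectiveDimensionLT n hj, Ext.comp_zero]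

lemma of_projective [Projective X] (φ : X ⟶ Y) : ExtVanish.{v, u, w} 1 φ := by
  rw [← Category.id_comp φ]
  exact of_factor (projective_iff_hasProjectiveDimensionLT_one.1 inferInstance) _ _

/-- A morphism inducing zero on `Ext¹` factors through any epimorphism onto its target. -/
lemma factors (h : ExtVanish.{v, u, w} 1 φ) {K P : C} {k : K ⟶ P} {p : P ⟶ Y} (hp : SES k p) :
    ∃ f : X ⟶ P, f ≫ p = φ := by
  obtain ⟨x, hx⟩ := Ext.covariant_sequence_exact₃ X hp.2 (Ext.mk₀ φ) (zero_add 1)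
    (h 1 le_rfl _ _)
  obtain ⟨f, rfl⟩ := (Ext.mk₀_bijective _ _).2 x
  exact ⟨f, (Ext.mk₀_bijective _ _).1 (by simpa using hx)⟩

end ExtVanish

/-- Dimension shift for morphisms. -/
lemma ExtVanish.shift {X Y X' Y' P Q : C} {a : X' ⟶ P} {b : P ⟶ X} (hX : SES a b) [Projective P]
    {c : Y' ⟶ Q} {d : Q ⟶ Y} (hY : SES c d) {φ : X ⟶ Y} {φ' : X' ⟶ Y'} {θ : P ⟶ Q}
    (h₁ : φ' ≫ c = a ≫ θ) (h₂ : θ ≫ d = b ≫ φ) {n : ℕ} (hn : 1 ≤ n)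
    (h : ExtVanish.{v, u, w} (n + 1) φ) : ExtVanish.{v, u, w} n φ' := by
  intro j hj Z α
  let τ : ShortComplex.mk a b hX.w ⟶ ShortComplex.mk c d hY.w :=
    { τ₁ := φ', τ₂ := θ, τ₃ := φ, comm₁₂ := h₁, comm₂₃ := h₂ }
  have hnat := ShortComplex.ShortExact.extClass_naturality hX.2 hY.2 τ
  have h0 : hX.2.extClass.comp ((Ext.mk₀ φ').comp α (zero_add j)) (add_comm 1 j) = 0 := by
    rw [← Ext.comp_assoc_of_second_deg_zero]
    change (hX.2.extClass.comp (Ext.mk₀ τ.τ₁) (add_zero 1)).comp α _ = 0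
    rw [hnat, Ext.comp_assoc (a₂₃ := j + 1) _ _ _ _ (by lia) (by lia)]
    exact h (j + 1) (by lia) _ _
  -- The pulled-back class has zero image under the connecting map, so it is restricted from
  -- `Ext^j(P, Z)`, which is zero because `j ≥ 1`.
  obtain ⟨x, hx⟩ := Ext.contravariant_sequence_exact₁ hX.2 Z _ _ h0
  obtain ⟨j, rfl⟩ : ∃ k, j = k + 1 := ⟨j - 1, by lia⟩
  have : x = 0 := Ext.eq_zero_of_projective (P := P) x
  rw [← hx, this, Ext.comp_zero]

end ExtVanish

end Basics

/-! ### Length functions and Fitting's lemma. -/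

section Length

/-- An abelian category with an additive length function taking natural numbers as values. -/
class HasLength (C : Type u) [Category.{v} C] [Abelian C] : Prop where
  exists_length : ∃ len : C → ℕ,
    (∀ {A B X : C} (f : A ⟶ B) (g : B ⟶ X), SES f g → len B = len A + len X) ∧
    ∀ X : C, len X = 0 → IsZero X

variable {C : Type u} [Category.{v} C] [Abelian C] [HasLength C]

/-- A chosen length function. -/
noncomputable def len : C → ℕ := (HasLength.exists_length (C := C)).choose

lemma len_ses {A B X : C} {f : A ⟶ B} {g : B ⟶ X} (h : SES f g) : len B = len A + len X :=
  (HasLength.exists_length (C := C)).choose_spec.1 f g h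

lemma isZero_of_len {X : C} (h : len X = 0) : IsZero X :=
  (HasLength.exists_length (C := C)).choose_spec.2 X h

lemma len_le_of_mono {X Y : C} (f : X ⟶ Y) [Mono f] : len X ≤ len Y := by
  have := len_ses (SES.ofCokernel f)
  lia

lemma isIso_of_mono_of_len {X Y : C} (f : X ⟶ Y) [Mono f] (h : len Y ≤ len X) : IsIso f := by
  have := len_ses (SES.ofCokernel f)
  have hz : IsZero (cokernel f) := isZero_of_len (by lia)
  have : Epi f := Preadditive.epi_of_isZero_cokernel f hz
  exact isIso_of_mono_of_epi f

lemma isIso_of_epi_of_len {X Y : C} (f : X ⟶ Y) [Epi f] (h : len X ≤ len Y) : IsIso f := by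
  have := len_ses (SES.ofKernel f)
  have hz : IsZero (kernel f) := isZero_of_len (by lia)
  have : Mono f := Preadditive.mono_of_isZero_kernel f hz
  exact isIso_of_mono_of_epi f

lemma len_iso {X Y : C} (e : X ≅ Y) : len X = len Y :=
  le_antisymm (len_le_of_mono e.hom) (len_le_of_mono e.inv)

lemma len_biprod (X Y : C) : len (X ⊞ Y) = len X + len Y := by
  refine len_ses (f := biprod.inl) (g := biprod.snd)
    (SES.mk' inferInstance inferInstance (by simp) fun Z x hx => ⟨x ≫ biprod.fst, ?_⟩)
  ext <;> simp [hx]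

lemma len_kernel_add {X Y I : C} (f : X ⟶ Y) (p : X ⟶ I) (i : I ⟶ Y) [Epi p] [Mono i]
    (h : p ≫ i = f) : len (kernel f) + len I = len X := by
  refine (len_ses (f := kernel.ι f) (g := p) (SES.mk' inferInstance inferInstance ?_ ?_)).symm
  · rw [← cancel_mono i]
    simp [h]
  · intro Z x hx
    exact ⟨kernel.lift f x (by rw [← h, reassoc_of% hx, zero_comp]), by simp⟩

/-- Fitting's lemma: some power of an endomorphism is strongly regular. -/
lemma fitting {X : C} (e : End X) :
    ∃ (k : ℕ) (h : End X), 1 ≤ k ∧ e ^ k * h = h * e ^ k ∧ e ^ k * (e ^ k * h) = e ^ k := by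
  -- Kernel lengths of powers are bounded by `len X`, so one is maximal; the shift `n + 1` ensures a
  -- positive exponent.
  let κ : ℕ → ℕ := fun n => len (kernel (e ^ (n + 1) : End X))
  have hb : ∀ n, κ n ≤ len X := fun n => len_le_of_mono (kernel.ι _)
  obtain ⟨n, hn⟩ : ∃ n, ∀ m, κ m ≤ κ n := by
    have hne : (Set.range κ).Nonempty := ⟨κ 0, 0, rfl⟩
    have hbd : BddAbove (Set.range κ) := ⟨len X, by rintro _ ⟨n, rfl⟩; exact hb n⟩
    obtain ⟨n, hn⟩ := Nat.sSup_mem hne hbd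
    exact ⟨n, fun m => hn ▸ le_csSup hbd ⟨m, rfl⟩⟩
  let f : X ⟶ X := (e ^ (n + 1) : End X)
  have hff : f ≫ f = (e ^ (2 * n + 1 + 1) : End X) := by
    change (e ^ (n + 1) * e ^ (n + 1) : End X) = _
    rw [← pow_add]
    congr 1
    lia
  let I := image f
  let p : X ⟶ I := factorThruImage f
  let i : I ⟶ X := image.ι f
  have hpi : p ≫ i = f := image.fac f
  have h1 := len_kernel_add f p i hpi
  have h2 := len_kernel_add (f ≫ f) (p ≫ factorThruImage (i ≫ p)) (image.ι (i ≫ p) ≫ i)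
    (by simp only [← hpi, Category.assoc, image.fac_assoc])
  have h3 : len (kernel (f ≫ f)) ≤ len (kernel f) := by
    rw [hff]
    exact hn (2 * n + 1)
  have : IsIso (image.ι (i ≫ p)) := isIso_of_mono_of_len _ (by lia)
  have : Epi (i ≫ p) := by
    rw [← image.fac (i ≫ p)]
    exact epi_comp _ _
  have : IsIso (i ≫ p) := isIso_of_epi_of_len _ le_rfl
  let s := inv (i ≫ p)
  have hs : i ≫ p ≫ s = 𝟙 _ := by
    rw [← Category.assoc]
    exact IsIso.hom_inv_id _
  have hs' : s ≫ i ≫ p = 𝟙 _ := IsIso.inv_hom_id _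
  -- On its image `f` restricts to the automorphism `i ≫ p` with inverse `s`; the witness inverts
  -- `f` there and vanishes on `kernel f`.
  refine ⟨n + 1, p ≫ s ≫ s ≫ i, by lia, ?_, ?_⟩
  · change (p ≫ s ≫ s ≫ i) ≫ f = f ≫ p ≫ s ≫ s ≫ i
    rw [← hpi]
    simp only [Category.assoc, reassoc_of% hs, reassoc_of% hs']
  · change ((p ≫ s ≫ s ≫ i) ≫ f) ≫ f = f
    rw [← hpi]
    simp only [Category.assoc, reassoc_of% hs']

end Length

/-! ### Retracts and idempotents. -/

section Retracts

variable {C : Type u} [Category.{v} C] [Abelian C]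

lemma exists_biprod_of_retract {X Y : C} (r : Retract X Y) :
    ∃ K : C, Nonempty (Y ≅ X ⊞ K) ∧ (IsZero K → IsIso r.r) := by
  have : Epi r.r := ⟨fun a b h => by simpa using r.i ≫= h⟩
  obtain ⟨e⟩ := (SES.ofKernel r.r).iso_of_retraction r.i r.retract
  refine ⟨kernel r.r, ⟨e ≪≫ biprod.braiding _ _⟩, fun h => ?_⟩
  have := Preadditive.mono_of_isZero_kernel r.r h
  exact isIso_of_mono_of_epi _

lemma exists_retract_of_idempotent {X : C} (π : X ⟶ X) (h : π ≫ π = π) :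
    ∃ (Y : C) (r : Retract Y X), r.r ≫ r.i = π := by
  obtain ⟨Y, i, e, h1, h2⟩ := IsIdempotentComplete.idempotents_split X π h
  exact ⟨Y, ⟨i, e, h1⟩, h2⟩

lemma Indecomposable.eq_zero_or_isIso {X : C} (hX : Indecomposable X) {Y : C} (r : Retract Y X) :
    IsZero Y ∨ IsIso r.r := by
  obtain ⟨K, ⟨e⟩, hK⟩ := exists_biprod_of_retract r
  exact (hX.2 _ _ e).imp id hK

end Retracts

lemma retract_of_isUnit {C : Type u} [Category.{v} C] {X W : C} {s : X ⟶ W} {t : W ⟶ X}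
    (h : IsUnit (M := End X) (s ≫ t)) :
    Nonempty (Retract X W) := by
  have : IsIso (s ≫ t) := (isUnit_iff_isIso _).1 h
  exact ⟨⟨s, t ≫ inv (s ≫ t), by
    rw [← Category.assoc]
    exact IsIso.hom_inv_id _⟩⟩

/-! ### Local endomorphism rings, Krull–Schmidt and cancellation. -/

section KrullSchmidt

variable {C : Type u} [Category.{v} C] [Abelian C] [HasLength C]

namespace Indecomposable

variable {X : C}

/-- Fitting's lemma yields the idempotent `h * e ^ k`, which must be 0 or 1 because it splits off a
summand of `X`. -/
lemma isIso_or_isNilpotent (hX : Indecomposable X) (e : End X) : IsUnit e ∨ IsNilpotent e := by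
  obtain ⟨k, h, hk, hc, he⟩ := fitting e
  let π : End X := h * e ^ k
  have hπ : π * π = π := by
    change h * e ^ k * (h * e ^ k) = h * e ^ k
    rw [← hc, mul_assoc, ← mul_assoc h, ← hc, ← mul_assoc, he]
  obtain ⟨Y, r, hr⟩ := exists_retract_of_idempotent (X := X) π hπ
  rcases eq_zero_or_isIso hX r with h0 | h1
  · right
    have : π = 0 := by
      rw [← hr, h0.eq_of_src r.i 0, comp_zero]
    refine ⟨k, ?_⟩
    rw [← he, hc]
    change e ^ k * π = 0
    rw [this, mul_zero]
  · left
    have h2 : π = 1 := by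
      rw [← hr, ← cancel_mono r.r]
      simp [End.one_def]
    rw [← isUnit_pow_iff (n := k) (by lia)]
    exact ⟨⟨e ^ k, h, hc.trans h2, h2⟩, rfl⟩

lemma isLocalRing_end (hX : Indecomposable X) : IsLocalRing (End X) := by
  have : Nontrivial (End X) :=
    nontrivial_of_ne (1 : End X) 0 fun h => hX.1 ((IsZero.iff_id_eq_zero X).2 h)
  exact .of_isUnit_or_isUnit_one_sub_self fun a =>
    (isIso_or_isNilpotent hX a).imp id fun h => h.isUnit_one_sub

lemma retract_of_addGen (hX : Indecomposable X) {T : C} (h : AddGen T X) : Nonempty (Retract X T) := by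
  obtain ⟨ι, _, s, t, hst⟩ := h
  have := isLocalRing_end hX
  have hu : IsUnit (∑ i, (show End X from s i ≫ t i)) := by
    have : ∑ i, (show End X from s i ≫ t i) = 1 := hst
    rw [this]
    exact isUnit_one
  obtain ⟨i, -, hi⟩ := IsLocalRing.exists_of_isUnit_sum hu
  exact retract_of_isUnit hi

lemma retract_of_biprod (hX : Indecomposable X) {Y Z : C} (r : Retract X (Y ⊞ Z)) :
    Nonempty (Retract X Y) ∨ Nonempty (Retract X Z) := by
  have := isLocalRing_end hX
  let a : End X := (r.i ≫ biprod.fst) ≫ (biprod.inl ≫ r.r)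
  let b : End X := (r.i ≫ biprod.snd) ≫ (biprod.inr ≫ r.r)
  have h : a + b = 1 := by
    have h1 := r.i ≫= (biprod.total (X := Y) (Y := Z)) =≫ r.r
    rw [Category.id_comp, r.retract] at h1
    refine Eq.trans ?_ h1
    simp only [a, b, Preadditive.comp_add, Preadditive.add_comp, Category.assoc]
  exact (IsLocalRing.isUnit_or_isUnit_of_isUnit_add (h ▸ isUnit_one)).imp
    (retract_of_isUnit) (retract_of_isUnit)

/-- Indecomposable objects can be cancelled from direct sums. -/
lemma cancel (hX : Indecomposable X) {U V : C} (e : X ⊞ U ≅ X ⊞ V) : Nonempty (U ≅ V) := by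
  have := isLocalRing_end hX
  let a : End X := biprod.inl ≫ e.hom ≫ biprod.fst
  by_cases h : IsUnit a
  · have : IsIso (biprod.inl ≫ e.hom ≫ biprod.fst) := (isUnit_iff_isIso _).1 h
    exact ⟨Biprod.isoElim e⟩
  · let a' : X ⟶ X := biprod.inl ≫ e.inv ≫ biprod.fst
    let c' : V ⟶ X := biprod.inr ≫ e.inv ≫ biprod.fst
    let b : End X := (biprod.inl ≫ e.hom ≫ biprod.fst) ≫ a'
    let c : End X := (biprod.inl ≫ e.hom ≫ biprod.snd) ≫ c'
    have hsum : b + c = 1 := by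
      have h1 := (biprod.inl ≫ e.hom) ≫= (biprod.total (X := X) (Y := V)) =≫ (e.inv ≫ biprod.fst)
      have h2 : (biprod.inl ≫ e.hom) ≫ 𝟙 (X ⊞ V) ≫ e.inv ≫ biprod.fst = 𝟙 X := by simp
      rw [h2] at h1
      refine Eq.trans ?_ h1
      simp only [b, c, a', c', Preadditive.comp_add, Preadditive.add_comp, Category.assoc]
    rcases IsLocalRing.isUnit_or_isUnit_of_isUnit_add (hsum ▸ isUnit_one) with hb | hc
    · have hb' : IsIso ((biprod.inl ≫ e.hom ≫ biprod.fst) ≫ a') := (isUnit_iff_isIso _).1 hb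
      have : Mono (biprod.inl ≫ e.hom ≫ biprod.fst) := mono_of_mono _ a'
      exact (h ((isUnit_iff_isIso _).2 (isIso_of_mono_of_len _ le_rfl))).elim
    -- This elementary operation replaces the corner entry `a` of `e` by `a + c`, the sum of a
    -- nonunit and a unit in a local ring, so Gaussian elimination applies.
    · let e' := e ≪≫ Biprod.unipotentLower c'
      have he' : biprod.inl ≫ e'.hom ≫ biprod.fst = a + c := by
        simp [e', a, c, Biprod.unipotentLower, Biprod.ofComponents]
      have hac : IsUnit (a + c) := by
        have h1 : a + c + -a = c := by abel
        rcases IsLocalRing.isUnit_or_isUnit_of_isUnit_add (h1 ▸ hc) with h2 | h2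
        · exact h2
        · exact (h (by simpa using h2)).elim
      have : IsIso (biprod.inl ≫ e'.hom ≫ biprod.fst) := by
        rw [he']
        exact (isUnit_iff_isIso _).1 hac
      exact ⟨Biprod.isoElim e'⟩

end Indecomposable

/-- Induction on a decomposition into indecomposable objects. -/
lemma indecomposable_induction {P : C → Prop} (hiso : ∀ {X Y : C}, (X ≅ Y) → P X → P Y)
    (hzero : P 0) (hind : ∀ X, Indecomposable X → P X) (hsum : ∀ X Y, P X → P Y → P (X ⊞ Y))
    (X : C) : P X := by
  induction hn : len X using Nat.strong_induction_on generalizing X with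
  | _ n ih =>
    by_cases h0 : IsZero X
    · exact hiso h0.isoZero.symm hzero
    by_cases hX : Indecomposable X
    · exact hind X hX
    simp only [Indecomposable, not_and, not_forall, not_or] at hX
    obtain ⟨Y, Z, e, hY, hZ⟩ := hX h0
    have h1 := (len_iso e).symm.trans hn
    rw [len_biprod] at h1
    have hY' : len Y ≠ 0 := fun h => hY (isZero_of_len h)
    have hZ' : len Z ≠ 0 := fun h => hZ (isZero_of_len h)
    exact hiso e.symm (hsum _ _ (ih _ (by lia) Y rfl) (ih _ (by lia) Z rfl))

lemma cancel_biprod (W : C) : ∀ {U V : C}, (W ⊞ U ≅ W ⊞ V) → Nonempty (U ≅ V) := by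
  refine indecomposable_induction (P := fun W => ∀ {U V : C}, (W ⊞ U ≅ W ⊞ V) → Nonempty (U ≅ V))
    ?_ ?_ ?_ ?_ W
  · intro X Y e h U V f
    exact h (biprod.mapIso e (Iso.refl U) ≪≫ f ≪≫ (biprod.mapIso e (Iso.refl V)).symm)
  · intro U V f
    exact ⟨(isoZeroBiprod (isZero_zero C)) ≪≫ f ≪≫ (isoZeroBiprod (isZero_zero C)).symm⟩
  · intro X hX U V f
    exact Indecomposable.cancel hX f
  · intro X Y hX hY U V f
    obtain ⟨g⟩ := hX ((biprod.associator X Y U).symm ≪≫ f ≪≫ biprod.associator X Y V)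
    exact hY g

/-- An indecomposable retract of a direct sum is a retract of one of the summands, since its
endomorphism ring is local. -/
lemma finite_indecomposable_addGen (M : C) : ∃ (n : ℕ) (F : Fin n → C),
    ∀ I, Indecomposable I → Nonempty (Retract I M) → ∃ i, Nonempty (I ≅ F i) := by
  refine indecomposable_induction (P := fun M => ∃ (n : ℕ) (F : Fin n → C),
    ∀ I, Indecomposable I → Nonempty (Retract I M) → ∃ i, Nonempty (I ≅ F i)) ?_ ?_ ?_ ?_ M
  · rintro X Y e ⟨n, F, hF⟩
    exact ⟨n, F, fun I hI ⟨r⟩ => hF I hI ⟨r.trans (e.symm.retract)⟩⟩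
  · refine ⟨0, Fin.elim0, fun I hI ⟨r⟩ => (hI.1 ?_).elim⟩
    rw [IsZero.iff_id_eq_zero, ← r.retract, (isZero_zero C).eq_of_src r.r 0, comp_zero]
  · refine fun X hX => ⟨1, fun _ => X, fun I hI ⟨r⟩ => ⟨0, ?_⟩⟩
    rcases Indecomposable.eq_zero_or_isIso hX r with h | h
    · exact (hI.1 h).elim
    · exact ⟨(asIso r.r).symm⟩
  · rintro X Y ⟨n, F, hF⟩ ⟨m, F', hF'⟩
    refine ⟨n + m, Fin.append F F', fun I hI ⟨r⟩ => ?_⟩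
    rcases Indecomposable.retract_of_biprod hI r with h | h
    · obtain ⟨i, hi⟩ := hF I hI h
      exact ⟨Fin.castAdd m i, by simpa using hi⟩
    · obtain ⟨i, hi⟩ := hF' I hI h
      exact ⟨Fin.natAdd n i, by simpa using hi⟩

end KrullSchmidt

/-! ### Stable isomorphism, Schanuel's lemma and the monoid of stable classes. -/

section Stable

variable {C : Type u} [Category.{v} C] [Abelian C]

/-- `U` and `V` are isomorphic up to projective direct summands. -/
def StableIso (U V : C) : Prop :=
  ∃ P Q : C, Projective P ∧ Projective Q ∧ Nonempty (U ⊞ P ≅ V ⊞ Q)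

/-- `(X ⊞ Y) ⊞ (Z ⊞ W) ≅ (X ⊞ Z) ⊞ (Y ⊞ W)`. -/
noncomputable def biprodSwapMiddle (X Y Z W : C) : (X ⊞ Y) ⊞ (Z ⊞ W) ≅ (X ⊞ Z) ⊞ (Y ⊞ W) where
  hom := biprod.desc (biprod.map biprod.inl biprod.inl) (biprod.map biprod.inr biprod.inr)
  inv := biprod.desc (biprod.map biprod.inl biprod.inl) (biprod.map biprod.inr biprod.inr)
  hom_inv_id := by ext <;> simp
  inv_hom_id := by ext <;> simp

namespace StableIso

variable {U V W : C}

lemma of_iso (e : U ≅ V) : StableIso U V :=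
  ⟨0, 0, inferInstance, inferInstance, ⟨biprod.mapIso e (Iso.refl _)⟩⟩

lemma symm (h : StableIso U V) : StableIso V U := by
  obtain ⟨P, Q, hP, hQ, ⟨e⟩⟩ := h
  exact ⟨Q, P, hQ, hP, ⟨e.symm⟩⟩

lemma trans (h : StableIso U V) (h' : StableIso V W) : StableIso U W := by
  obtain ⟨P, Q, hP, hQ, ⟨e⟩⟩ := h
  obtain ⟨P', Q', hP', hQ', ⟨e'⟩⟩ := h'
  exact ⟨P ⊞ P', Q' ⊞ Q, inferInstance, inferInstance,
    ⟨(biprod.associator _ _ _).symm ≪≫ biprod.mapIso e (Iso.refl P') ≪≫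
      biprod.associator _ _ _ ≪≫ biprod.mapIso (Iso.refl V) (biprod.braiding Q P') ≪≫
      (biprod.associator _ _ _).symm ≪≫ biprod.mapIso e' (Iso.refl Q) ≪≫ biprod.associator _ _ _⟩⟩

lemma biprod (h : StableIso U V) {U' V' : C} (h' : StableIso U' V') :
    StableIso (U ⊞ U') (V ⊞ V') := by
  obtain ⟨P, Q, hP, hQ, ⟨e⟩⟩ := h
  obtain ⟨P', Q', hP', hQ', ⟨e'⟩⟩ := h'
  exact ⟨P ⊞ P', Q ⊞ Q', inferInstance, inferInstance,
    ⟨biprodSwapMiddle _ _ _ _ ≪≫ biprod.mapIso e e' ≪≫ biprodSwapMiddle _ _ _ _⟩⟩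

lemma of_biprod_projective (U P : C) [Projective P] : StableIso (U ⊞ P) U :=
  ⟨0, P ⊞ 0, inferInstance, inferInstance, ⟨biprod.associator _ _ _⟩⟩

lemma cancel [HasLength C] (W : C) (h : StableIso (W ⊞ U) (W ⊞ V)) : StableIso U V := by
  obtain ⟨P, Q, hP, hQ, ⟨e⟩⟩ := h
  exact ⟨P, Q, hP, hQ, cancel_biprod W
    ((biprod.associator _ _ _).symm ≪≫ e ≪≫ biprod.associator _ _ _)⟩

end StableIso

/-- Schanuel's lemma. -/
lemma schanuel {K P K' P' X : C} {k : K ⟶ P} {p : P ⟶ X} (h : SES k p) {k' : K' ⟶ P'}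
    {p' : P' ⟶ X} (h' : SES k' p') [Projective P] [Projective P'] : StableIso K K' := by
  have key : ∀ {K P K' P' : C} {k : K ⟶ P} {p : P ⟶ X} (_ : SES k p) {k' : K' ⟶ P'}
      {p' : P' ⟶ X} (_ : SES k' p') [Projective P'], Nonempty (pullback p p' ≅ K ⊞ P') := by
    intro K P K' P' k p h k' p' h' _
    have := h.mono
    have := h.epi
    let j : K ⟶ pullback p p' := pullback.lift k 0 (by rw [h.w, zero_comp])
    have hj : j ≫ pullback.fst p p' = k := pullback.lift_fst _ _ _
    have hj' : j ≫ pullback.snd p p' = 0 := pullback.lift_snd _ _ _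
    refine (SES.mk' (f := j) (g := pullback.snd p p')
      ?_ inferInstance hj' ?_).iso_of_projective
    · have : Mono (j ≫ pullback.fst p p') := by
        rw [hj]
        infer_instance
      exact mono_of_mono _ (pullback.fst p p')
    · intro Z x hx
      obtain ⟨y, hy⟩ := h.lift (x ≫ pullback.fst p p') (by
        rw [Category.assoc, pullback.condition, reassoc_of% hx, zero_comp])
      exact ⟨y, by ext <;> simp [hj, hj', hy, hx]⟩
  obtain ⟨e⟩ := key h h'
  obtain ⟨e'⟩ := key h' h
  exact ⟨P', P, inferInstance, inferInstance, ⟨e.symm ≪≫ pullbackSymmetry _ _ ≪≫ e'⟩⟩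

lemma schanuel_stable {K P K' P' X X' : C} {k : K ⟶ P} {p : P ⟶ X} (h : SES k p) {k' : K' ⟶ P'}
    {p' : P' ⟶ X'} (h' : SES k' p') [Projective P] [Projective P'] (e : StableIso X X') :
    StableIso K K' := by
  obtain ⟨A, B, hA, hB, ⟨e⟩⟩ := e
  have key : ∀ {K P X : C} {k : K ⟶ P} {p : P ⟶ X} (_ : SES k p) (A : C),
      SES (k ≫ biprod.inl : K ⟶ P ⊞ A) (biprod.map p (𝟙 A)) := by
    intro K P X k p h A
    have := h.mono
    have := h.epi
    refine SES.mk' inferInstance inferInstance (by ext <;> simp [h.w]) fun Z x hx => ?_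
    obtain ⟨y, hy⟩ := h.lift (x ≫ biprod.fst) (by simpa using hx =≫ biprod.fst)
    refine ⟨y, ?_⟩
    have h2 : x ≫ biprod.snd = 0 := by simpa using hx =≫ biprod.snd
    ext <;> simp [reassoc_of% hy, h2]
  have h1 := (key h A).comp_iso (Iso.refl _) e
  exact schanuel h1 (key h' B)

section Syzygy

variable [EnoughProjectives C]

/-- A (not necessarily minimal) first syzygy. -/
noncomputable def syz (X : C) : C := kernel (Projective.π X)

/-- The inclusion of the syzygy. -/
noncomputable def syzι (X : C) : syz X ⟶ Projective.over X := kernel.ι (Projective.π X)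

lemma syz_ses (X : C) : SES (syzι X) (Projective.π X) :=
  SES.ofKernel _

lemma syz_stableIso {X X' : C} (h : StableIso X X') : StableIso (syz X) (syz X') :=
  schanuel_stable (syz_ses X) (syz_ses X') h

lemma syz_of_ses {K P X : C} {k : K ⟶ P} {p : P ⟶ X} (h : SES k p) [Projective P] :
    StableIso K (syz X) :=
  schanuel h (syz_ses X)

lemma syz_biprod (X Y : C) : StableIso (syz (X ⊞ Y)) (syz X ⊞ syz Y) :=
  (syz_of_ses ((syz_ses X).biprod (syz_ses Y))).symm

end Syzygy

variable (C) in
/-- Stable isomorphism, as a setoid. -/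
def stableSetoid : Setoid C where
  r := StableIso
  iseqv := ⟨fun X => .of_iso (Iso.refl X), .symm, .trans⟩

variable (C) in
/-- The monoid of stable isomorphism classes under direct sum. -/
def StableClass : Type u := Quotient (stableSetoid C)

namespace StableClass

/-- The class of an object. -/
def mk (X : C) : StableClass C := Quotient.mk (stableSetoid C) X

lemma mk_eq {X Y : C} : mk X = mk Y ↔ StableIso X Y := Quotient.eq (r := stableSetoid C)

noncomputable instance : Zero (StableClass C) := ⟨mk 0⟩

noncomputable instance : Add (StableClass C) :=
  ⟨Quotient.map₂ (fun X Y => X ⊞ Y) fun _ _ h _ _ h' => StableIso.biprod h h'⟩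

lemma mk_iso {X Y : C} (e : X ≅ Y) : mk X = mk Y := mk_eq.2 (.of_iso e)

lemma ind {P : StableClass C → Prop} (h : ∀ X, P (mk X)) (x : StableClass C) : P x :=
  Quotient.inductionOn x h

noncomputable instance : AddCommMonoid (StableClass C) where
  add_assoc x y z := by
    induction x using ind with | h X
    induction y using ind with | h Y
    induction z using ind with | h Z
    exact mk_iso (biprod.associator X Y Z)
  zero_add x := by
    induction x using ind with | h X
    exact mk_iso (isoZeroBiprod (isZero_zero C)).symm
  add_zero x := by
    induction x using ind with | h X
    exact mk_iso (isoBiprodZero (isZero_zero C)).symm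
  add_comm x y := by
    induction x using ind with | h X
    induction y using ind with | h Y
    exact mk_iso (biprod.braiding X Y)
  nsmul := nsmulRec

/-- Cancellation is what makes the monoid embed in its Grothendieck group. -/
instance [HasLength C] : IsCancelAdd (StableClass C) := by
  have : IsLeftCancelAdd (StableClass C) := ⟨fun x y z h => by
    induction x using ind with | h X
    induction y using ind with | h Y
    induction z using ind with | h Z
    exact mk_eq.2 (StableIso.cancel X (mk_eq.1 h))⟩
  exact AddCommMagma.IsLeftCancelAdd.toIsCancelAdd _

/-- The syzygy operator on stable isomorphism classes. -/
noncomputable def syzHom [EnoughProjectives C] : StableClass C →+ StableClass C where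
  toFun := Quotient.map syz fun _ _ h => syz_stableIso h
  map_zero' := by
    refine mk_eq.2 ?_
    have : SES (0 : (0 : C) ⟶ 0) (0 : (0 : C) ⟶ (0 : C)) :=
      SES.mk' ⟨fun _ _ _ => (isZero_zero C).eq_of_tgt _ _⟩
        ⟨fun _ _ _ => (isZero_zero C).eq_of_src _ _⟩
        (by simp) fun Z x _ => ⟨0, (isZero_zero C).eq_of_tgt _ _⟩
    exact (syz_of_ses this).symm
  map_add' x y := by
    induction x using ind with | h X
    induction y using ind with | h Y
    exact mk_eq.2 (syz_biprod X Y)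

lemma syzHom_mk [EnoughProjectives C] (X : C) : syzHom (mk X) = mk (syz X) := rfl

/-- Indecomposable objects of `add M` are retracts of `M`, so finitely many classes generate. -/
lemma exists_finite_closure [HasLength C] (M : C) : ∃ F : Set (StableClass C), F.Finite ∧
    ∀ A, AddGen M A → mk A ∈ AddSubmonoid.closure F := by
  obtain ⟨n, F, hF⟩ := finite_indecomposable_addGen M
  refine ⟨Set.range fun i => mk (F i), Set.finite_range _, fun A => ?_⟩
  refine indecomposable_induction
    (P := fun A => AddGen M A → mk A ∈ AddSubmonoid.closure (Set.range fun i => mk (F i)))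
    ?_ ?_ ?_ ?_ A
  · intro X Y e h hY
    rw [← mk_iso e]
    exact h (hY.of_iso e)
  · intro _
    exact zero_mem _
  · intro X hX h
    obtain ⟨i, ⟨e⟩⟩ := hF X hX (Indecomposable.retract_of_addGen hX h)
    exact AddSubmonoid.subset_closure ⟨i, (mk_iso e).symm⟩
  · intro X Y hX hY h
    exact add_mem (hX (h.of_retract ⟨biprod.inl, biprod.fst, by simp⟩))
      (hY (h.of_retract ⟨biprod.inr, biprod.snd, by simp⟩))

end StableClass

end Stable

/-! ### A uniform stage for equality of iterates. -/

section Monoid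

/-- For an additive endomorphism of a cancellative commutative monoid, equality of iterates on a
finitely generated submonoid can be detected at a uniform stage. -/
lemma exists_iterate_bound {S : Type u} [AddCommMonoid S] [IsCancelAdd S] (L : S →+ S)
    (F : Set S) (hF : F.Finite) : ∃ n : ℕ, ∀ x ∈ AddSubmonoid.closure F,
      ∀ y ∈ AddSubmonoid.closure F, (∃ r, L^[r] x = L^[r] y) → L^[n] x = L^[n] y := by
  let G := Algebra.GrothendieckAddGroup S
  let of : S →+ G := Algebra.GrothendieckAddGroup.of
  have hof : Function.Injective of := Algebra.GrothendieckAddGroup.of_injective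
  let Lg : G →+ G := Algebra.GrothendieckAddGroup.lift (of.comp L)
  have hLg1 : ∀ x, Lg (of x) = of (L x) := fun x =>
    DFunLike.congr_fun (Algebra.GrothendieckAddGroup.lift.symm_apply_apply (of.comp L)) x
  have hLg : ∀ (n : ℕ) x, Lg^[n] (of x) = of (L^[n] x) := fun n x =>
    (Function.Semiconj.iterate_right (f := of) (ga := L) (gb := Lg) (fun x => (hLg1 x).symm) n
      x).symm
  let H : Submodule ℤ G := Submodule.span ℤ (of '' F)
  have hH : ∀ x ∈ AddSubmonoid.closure F, of x ∈ H := by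
    intro x hx
    induction hx using AddSubmonoid.closure_induction with
    | mem x hx => exact Submodule.subset_span ⟨x, hx, rfl⟩
    | zero => rw [map_zero]; exact zero_mem _
    | add x y _ _ hx hy => rw [map_add]; exact add_mem hx hy
  have : Module.Finite ℤ H := Module.Finite.iff_fg.2 (Submodule.fg_span (hF.image _))
  -- The kernels of the powers of `Lg` on `H` form an ascending chain in a noetherian `ℤ`-module.
  -- `H` need not be stable under `Lg`, so the powers are taken on `G` and then restricted.
  let K : ℕ →o Submodule ℤ H :=
    { toFun := fun n => LinearMap.ker (((Lg.toIntLinearMap) ^ n).comp H.subtype)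
      monotone' := by
        refine monotone_nat_of_le_succ fun n x hx => ?_
        simp only [LinearMap.mem_ker, LinearMap.comp_apply] at hx ⊢
        rw [pow_succ', Module.End.mul_apply, hx, map_zero] }
  obtain ⟨n, hn⟩ := monotone_stabilizes_iff_noetherian.2 (inferInstanceAs (IsNoetherian ℤ H)) K
  have hmem : ∀ (m : ℕ) x (hx : x ∈ AddSubmonoid.closure F) y (hy : y ∈ AddSubmonoid.closure F),
      (⟨of x, hH x hx⟩ - ⟨of y, hH y hy⟩ : H) ∈ K m ↔ L^[m] x = L^[m] y := by
    intro m x hx y hy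
    change ((Lg.toIntLinearMap) ^ m) (of x - of y) = 0 ↔ _
    rw [map_sub, sub_eq_zero, Module.End.pow_apply, Module.End.pow_apply]
    change Lg^[m] (of x) = Lg^[m] (of y) ↔ _
    rw [hLg, hLg, hof.eq_iff]
  refine ⟨n, fun x hx y hy ⟨r, hr⟩ => ?_⟩
  rw [← hmem n x hx y hy]
  rcases le_total n r with h | h
  · rw [hn r h]
    exact (hmem r x hx y hy).2 hr
  · exact K.monotone h ((hmem r x hx y hy).2 hr)

end Monoid

/-! ### Uniform Ext-vanishing, and syzygies of additive closures. -/

section IgusaTodorov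

variable {C : Type u} [Category.{v} C] [Abelian C]

/-- `f` is a finite sum of morphisms factoring through `T`. -/
def FactorsThrough (T : C) {X Y : C} (f : X ⟶ Y) : Prop :=
  ∃ (ι : Type) (_ : Fintype ι) (s : ι → (X ⟶ T)) (t : ι → (T ⟶ Y)), ∑ i, s i ≫ t i = f

namespace FactorsThrough

variable {T X Y : C}

lemma zero : FactorsThrough T (0 : X ⟶ Y) :=
  ⟨Empty, inferInstance, Empty.elim, Empty.elim, by simp⟩

lemma add {f g : X ⟶ Y} (hf : FactorsThrough T f) (hg : FactorsThrough T g) :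
    FactorsThrough T (f + g) := by
  obtain ⟨ι, _, s, t, h⟩ := hf
  obtain ⟨κ, _, s', t', h'⟩ := hg
  exact ⟨ι ⊕ κ, inferInstance, Sum.elim s s', Sum.elim t t', by simp [h, h']⟩

lemma sum {ι : Type} (S : Finset ι) {f : ι → (X ⟶ Y)} (h : ∀ i ∈ S, FactorsThrough T (f i)) :
    FactorsThrough T (∑ i ∈ S, f i) :=
  Finset.sum_induction _ _ (fun _ _ => add) zero h

lemma comp {Z : C} (hZ : AddGen T Z) (a : X ⟶ Z) (b : Z ⟶ Y) : FactorsThrough T (a ≫ b) := by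
  obtain ⟨ι, _, s, t, h⟩ := hZ
  refine ⟨ι, ‹_›, fun i => a ≫ s i, fun i => t i ≫ b, ?_⟩
  have := a ≫= h =≫ b
  simpa [Preadditive.comp_sum, Preadditive.sum_comp] using this

end FactorsThrough

lemma SES.exists_lift {X Y X' Y' P Q : C} {a : X' ⟶ P} {b : P ⟶ X} (hX : SES a b) [Projective P]
    {c : Y' ⟶ Q} {d : Q ⟶ Y} (hY : SES c d) (f : X ⟶ Y) :
    ∃ (θ : P ⟶ Q) (f' : X' ⟶ Y'), f' ≫ c = a ≫ θ ∧ θ ≫ d = b ≫ f := by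
  have := hY.epi
  have h : Projective.factorThru (b ≫ f) d ≫ d = b ≫ f := by simp
  obtain ⟨f', hf'⟩ := hY.lift (a ≫ Projective.factorThru (b ≫ f) d) (by
    rw [Category.assoc, h, reassoc_of% hX.w, zero_comp])
  exact ⟨_, f', hf', h⟩

lemma SES.exists_factor {X' Y' Y P Q : C} {a : X' ⟶ P}
    {c : Y' ⟶ Q} {d : Q ⟶ Y} (hY : SES c d) {f' : X' ⟶ Y'} {θ : P ⟶ Q}
    (h : f' ≫ c = a ≫ θ) (h0 : θ ≫ d = 0) : ∃ t : P ⟶ Y', a ≫ t = f' := by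
  have := hY.mono
  obtain ⟨t, ht⟩ := hY.lift θ h0
  exact ⟨t, by rw [← cancel_mono c, Category.assoc, ht, h]⟩

section Ext

/-- All endomorphism rings are noetherian. -/
class HasNoetherianEnd (C : Type u) [Category.{v} C] [Abelian C] : Prop where
  isNoetherianRing_end (X : C) : IsNoetherianRing (End X)

open Abelian

variable [HasExt.{w} C]

/-- The endomorphisms of `T` killing all `Ext^j` with `j ≥ n` form left ideals increasing with `n`.
A morphism in `add T` is tested through its matrix entries in `End T`. -/
lemma exists_extVanish_bound [HasNoetherianEnd C] (T : C) :
    ∃ n : ℕ, ∀ Y Y' : C, AddGen T Y → AddGen T Y' → ∀ φ : Y ⟶ Y',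
      (∃ r, ExtVanish.{v, u, w} r φ) → ExtVanish.{v, u, w} n φ := by
  let K : ℕ →o Ideal (End T) :=
    { toFun := fun n =>
        { carrier := {φ | ExtVanish.{v, u, w} (X := T) (Y := T) n φ}
          add_mem' := fun h h' => ExtVanish.add h h'
          zero_mem' := ExtVanish.zero
          smul_mem' := fun c φ h => ExtVanish.postcomp (φ := (φ : T ⟶ T)) h c }
      monotone' := fun n m hnm φ h => ExtVanish.mono h hnm }
  obtain ⟨n, hn⟩ := monotone_stabilizes_iff_noetherian.2
    (HasNoetherianEnd.isNoetherianRing_end T) K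
  refine ⟨n, ?_⟩
  rintro Y Y' ⟨ι, _, s, t, h⟩ ⟨κ, _, s', t', h'⟩ φ ⟨r, hr⟩
  have key : ∀ i j, ExtVanish.{v, u, w} n (t i ≫ φ ≫ s' j) := by
    intro i j
    have h1 : ExtVanish.{v, u, w} r (t i ≫ φ ≫ s' j) := (hr.postcomp _).precomp _
    change (show End T from t i ≫ φ ≫ s' j) ∈ K n
    rcases le_total n r with h2 | h2
    · rw [hn r h2]
      exact h1
    · exact h1.mono h2
  have h1 : φ = ∑ i, ∑ j, s i ≫ (t i ≫ φ ≫ s' j) ≫ t' j := by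
    calc φ = 𝟙 Y ≫ φ ≫ 𝟙 Y' := by simp
      _ = _ := by
        rw [← h, ← h']
        simp only [Preadditive.sum_comp, Preadditive.comp_sum, Category.assoc]
        exact Finset.sum_comm
  rw [h1]
  exact ExtVanish.sum _ fun i _ => ExtVanish.sum _ fun j _ => ((key i j).postcomp _).precomp _

lemma ExtVanish.comp_eq {n : ℕ} {X Y : C} {φ ψ : X ⟶ Y} (h : ExtVanish.{v, u, w} n (φ - ψ)) {j : ℕ}
    (hj : n ≤ j) {Z : C} (α : Ext.{w} Y Z j) :
    (Ext.mk₀ φ).comp α (zero_add j) = (Ext.mk₀ ψ).comp α (zero_add j) := by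
  have h1 := h j hj Z α
  rw [sub_eq_add_neg, Ext.mk₀_add, Ext.mk₀_neg, Ext.add_comp, Ext.neg_comp] at h1
  rwa [← sub_eq_zero, sub_eq_add_neg]

/-- Restricting an isomorphism `A ⊞ P ≅ B ⊞ Q` to its corners leaves an error that factors through a
projective, invisible to `Ext^j` for `j ≥ 1`. -/
lemma StableIso.exists_inverse {A B : C} (h : StableIso A B) :
    ∃ (θ : B ⟶ A) (θ' : A ⟶ B), ExtVanish.{v, u, w} 1 (θ ≫ θ' - 𝟙 B) ∧
      ExtVanish.{v, u, w} 1 (θ' ≫ θ - 𝟙 A) := by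
  obtain ⟨P, Q, hP, hQ, ⟨e⟩⟩ := h
  have key : ∀ {A B P Q : C} [Projective Q] (e : A ⊞ P ≅ B ⊞ Q),
      ExtVanish.{v, u, w} 1 ((biprod.inl ≫ e.hom ≫ biprod.fst) ≫ (biprod.inl ≫ e.inv ≫ biprod.fst) -
        𝟙 A) := by
    intro A B P Q _ e
    have h1 : (biprod.inl ≫ e.hom) ≫ (biprod.fst ≫ biprod.inl + biprod.snd ≫ biprod.inr) ≫
        e.inv ≫ biprod.fst = 𝟙 A := by
      rw [biprod.total]
      simp
    have h2 : (biprod.inl ≫ e.hom ≫ biprod.fst) ≫ (biprod.inl ≫ e.inv ≫ biprod.fst) - 𝟙 A =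
        (biprod.inl ≫ e.hom ≫ biprod.snd) ≫ (-(𝟙 Q) ≫ biprod.inr ≫ e.inv ≫ biprod.fst) := by
      rw [← h1]
      simp only [Preadditive.comp_add, Preadditive.add_comp, Category.assoc,
        Preadditive.comp_neg, Category.id_comp]
      abel
    rw [h2]
    exact ExtVanish.precomp (ExtVanish.of_projective _) _
  exact ⟨biprod.inl ≫ e.inv ≫ biprod.fst, biprod.inl ≫ e.hom ≫ biprod.fst, key e.symm, key e⟩

end Ext

/-- An abelian category with a projective object `G` such that every object is a quotient of a
direct summand of a finite direct sum of copies of `G`. -/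
class HasProjectiveGenerator (C : Type u) [Category.{v} C] [Abelian C] : Prop where
  exists_generator : ∃ G : C, Projective G ∧ ∀ X : C, ∃ (P : C) (p : P ⟶ X), Epi p ∧ AddGen G P

variable [HasProjectiveGenerator C]

variable (C) in
/-- A chosen projective generator. -/
noncomputable def gen : C := (HasProjectiveGenerator.exists_generator (C := C)).choose

instance : Projective (gen C) :=
  (HasProjectiveGenerator.exists_generator (C := C)).choose_spec.1

lemma exists_epi_of_gen (X : C) : ∃ (P : C) (p : P ⟶ X), Epi p ∧ AddGen (gen C) P :=
  (HasProjectiveGenerator.exists_generator (C := C)).choose_spec.2 X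

instance : EnoughProjectives C where
  presentation X := by
    obtain ⟨P, p, hp, hP⟩ := exists_epi_of_gen X
    have := hP.projective
    exact ⟨{ p := P, f := p }⟩

lemma AddGen.of_projective (P : C) [Projective P] : AddGen (gen C) P := by
  obtain ⟨Q, p, hp, hQ⟩ := exists_epi_of_gen P
  exact hQ.of_retract ⟨Projective.factorThru (𝟙 P) p, p, by simp⟩

/-- Syzygies are functorial only up to maps through projectives, and `gen C` absorbs the error term.
-/
lemma AddGen.syz {T X : C} (hX : AddGen T X) : AddGen (ExtDim.syz T ⊞ gen C) (ExtDim.syz X) := by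
  obtain ⟨ι, _, s, t, h⟩ := hX
  choose sl s' hs hs' using fun i => (syz_ses X).exists_lift (syz_ses T) (s i)
  choose tl t' ht ht' using fun i => (syz_ses T).exists_lift (syz_ses X) (t i)
  obtain ⟨d, hd⟩ := (syz_ses X).exists_factor (a := syzι X)
    (f' := 𝟙 _ - ∑ i, s' i ≫ t' i) (θ := 𝟙 _ - ∑ i, sl i ≫ tl i)
    (by
      simp only [Preadditive.sub_comp, Preadditive.comp_sub, Preadditive.sum_comp,
        Preadditive.comp_sum, Category.assoc, ht]
      simp only [reassoc_of% hs, Category.id_comp, Category.comp_id])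
    (by
      simp only [Preadditive.sub_comp, Preadditive.sum_comp, Category.assoc, ht']
      simp only [reassoc_of% hs', ← Preadditive.comp_sum, h, Category.id_comp, Category.comp_id,
        sub_self])
  have h1 : ∑ i, s' i ≫ t' i + syzι X ≫ d = 𝟙 (ExtDim.syz X) := by
    rw [hd]
    abel
  change FactorsThrough _ (𝟙 (ExtDim.syz X))
  rw [← h1]
  exact (FactorsThrough.sum _ fun i _ => .comp ((AddGen.self _).inl _) _ _).add
    (.comp ((AddGen.of_projective _).inr _) _ _)

end IgusaTodorov

/-! ### The Igusa–Todorov bound. -/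

section IgusaTodorovBound

open Abelian

variable {C : Type u} [Category.{v} C] [Abelian C]

lemma fitting_idempotent [HasLength C] {X : C} (e : End X) :
    ∃ (k : ℕ) (h : End X), e ^ (k + 1) * h = h * e ^ (k + 1) ∧
      e ^ (k + 1) * (e ^ (k + 1) * h) = e ^ (k + 1) := by
  obtain ⟨k, h, hk, h1, h2⟩ := fitting e
  obtain ⟨k, rfl⟩ : ∃ l, k = l + 1 := ⟨k - 1, by lia⟩
  exact ⟨k, h, h1, h2⟩

lemma pow_comp_surjective [HasExt.{w} C] {A Z : C} (g : End A) {j : ℕ}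
    (hg : ∀ α : Ext.{w} A Z j, ∃ β : Ext.{w} A Z j, (Ext.mk₀ g).comp β (zero_add j) = α)
    (n : ℕ) (α : Ext.{w} A Z j) :
    ∃ β : Ext.{w} A Z j, (Ext.mk₀ (g ^ n : End A)).comp β (zero_add j) = α := by
  induction n generalizing α with
  | zero => exact ⟨α, Ext.mk₀_id_comp α⟩
  | succ n ih =>
    obtain ⟨β, rfl⟩ := hg α
    obtain ⟨γ, rfl⟩ := ih β
    refine ⟨γ, ?_⟩
    rw [Ext.mk₀_comp_mk₀_assoc]
    rfl

/-- After `r` syzygies the third term is projective and the sequence splits. -/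
lemma SES.stableClass_iterate_eq [EnoughProjectives C] {r : ℕ} : ∀ {A B X : C} {f : A ⟶ B} {g : B ⟶ X}, SES f g →
    HasProjectiveDimensionLT X (r + 1) →
    StableClass.syzHom^[r] (StableClass.mk A) = StableClass.syzHom^[r] (StableClass.mk B) := by
  induction r with
  | zero =>
    intro A B X f g h hX
    have : Projective X := projective_iff_hasProjectiveDimensionLT_one.2 hX
    obtain ⟨e⟩ := h.iso_of_projective
    exact StableClass.mk_eq.2 ((StableIso.of_biprod_projective A X).symm.trans (.of_iso e.symm))
  | succ r ih =>
    intro A B X f g h hX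
    obtain ⟨K, k, l, i, p, hl, hp, -⟩ := horseshoe h (syz_ses A) (syz_ses X)
    rw [Function.iterate_succ_apply, Function.iterate_succ_apply, StableClass.syzHom_mk,
      StableClass.syzHom_mk, ← StableClass.mk_eq.2 (syz_of_ses hl)]
    exact ih hp (((syz_ses X).2.hasProjectiveDimensionLT_X₃_iff r
      (inferInstanceAs (Projective (Projective.over X)))).1 hX)

variable [HasLength C] [HasNoetherianEnd C]

/-- With a stable inverse `θ`, the map `f` becomes an endomorphism `g = f ≫ θ` of `A`. In high
degrees `g` acts surjectively on Ext, so its Fitting-nilpotent part acts as zero there, hence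
already from the uniform degree `n` on. From then on `g`, and so `f`, acts bijectively on Ext, which
forces `Ext(X, -)` to vanish one degree higher. -/
lemma exists_bound_of_stableIso (M : C) : ∃ d : ℕ, ∀ (A B X : C) (f : A ⟶ B) (g : B ⟶ X),
    SES f g → AddGen M A → StableIso A B → (∃ r, HasProjectiveDimensionLT X r) →
      HasProjectiveDimensionLT X d := by
  let := HasExt.standard C
  obtain ⟨n, hn⟩ := exists_extVanish_bound.{v, u, max u v} M
  refine ⟨max n 1 + 1, ?_⟩
  rintro A B X f p hS hA hAB ⟨r, hr⟩
  obtain ⟨θ, θ', hθ, hθ'⟩ := hAB.exists_inverse.{v, u, max u v}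
  let g : End A := f ≫ θ
  obtain ⟨k, h, hc, hg⟩ := fitting_idempotent g
  have hθeq : ∀ {j : ℕ} (_ : 1 ≤ j) {Z : C} (α : Ext.{max u v} B Z j),
      (Ext.mk₀ θ).comp ((Ext.mk₀ θ').comp α (zero_add j)) (zero_add j) = α := by
    intro j hj Z α
    rw [Ext.mk₀_comp_mk₀_assoc, hθ.comp_eq hj, Ext.mk₀_id_comp]
  -- `π` is the projection onto the part of `A` on which `g` is nilpotent
  let γ : A ⟶ A := (g ^ (k + 1) : End A)
  let ρ : A ⟶ A := (g ^ (k + 1) * h : End A)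
  let π : A ⟶ A := 𝟙 A - ρ
  have hπ0 : π ≫ γ = 0 := by
    have h1 : ρ ≫ γ = γ := hg
    rw [Preadditive.sub_comp, Category.id_comp, h1, sub_self]
  have hπ : ExtVanish.{v, u, max u v} n π := by
    -- In degrees `j ≥ max r 1` every class is pulled back along `γ`, and `π ≫ γ = 0`; `hn` then
    -- replaces this bound, which depends on `X`, by `n`.
    refine hn A A hA hA π ⟨max r 1, fun j hj Z α => ?_⟩
    obtain ⟨β, rfl⟩ := pow_comp_surjective g (j := j) (Z := Z) (fun α => by
      obtain ⟨x, hx⟩ := Ext.contravariant_sequence_exact₁ hS.2 Z α (add_comm 1 j)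
        ((hS.2.extClass.comp α (add_comm 1 j)).eq_zero_of_hasProjectiveDimensionLT r
          ((le_max_left r 1).trans (hj.trans (Nat.le_succ j))))
      refine ⟨(Ext.mk₀ θ').comp x (zero_add j), ?_⟩
      change (Ext.mk₀ (f ≫ θ)).comp _ _ = _
      rw [← Ext.mk₀_comp_mk₀_assoc, hθeq (by lia), hx]) (k + 1) α
    rw [Ext.mk₀_comp_mk₀_assoc]
    change (Ext.mk₀ (π ≫ γ)).comp β _ = 0
    rw [hπ0, Ext.mk₀_zero, Ext.zero_comp]
  have hgh : ∀ {j : ℕ} (_ : n ≤ j) {Z : C} (α : Ext.{max u v} A Z j),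
      (Ext.mk₀ ρ).comp α (zero_add j) = α := by
    intro j hj Z α
    rw [← ExtVanish.comp_eq hπ hj α, Ext.mk₀_id_comp]
  refine HasProjectiveDimensionLT.mk fun i hi Z y => ?_
  obtain ⟨j, rfl⟩ : ∃ j, i = j + 1 := ⟨i - 1, by lia⟩
  have hj : n ≤ j := by lia
  have hj1 : 1 ≤ j := by lia
  have hinj : (Ext.mk₀ p).comp y (zero_add (j + 1)) = 0 := by
    let z := (Ext.mk₀ p).comp y (zero_add (j + 1))
    let x := (Ext.mk₀ θ').comp z (zero_add (j + 1))
    have h1 : (Ext.mk₀ g).comp x (zero_add (j + 1)) = 0 := by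
      change (Ext.mk₀ (f ≫ θ)).comp _ _ = _
      rw [← Ext.mk₀_comp_mk₀_assoc, hθeq (by lia)]
      change (Ext.mk₀ f).comp ((Ext.mk₀ p).comp y _) _ = 0
      rw [Ext.mk₀_comp_mk₀_assoc, hS.w, Ext.mk₀_zero, Ext.zero_comp]
    have h2 : x = 0 := by
      rw [← hgh (by lia : n ≤ j + 1) x]
      -- As `ρ` acts as the identity, having `g` as its last factor makes `g` act injectively;
      -- having it as first factor, in `h4` below, gives surjectivity.
      have h3 : ρ = (h ≫ (g ^ k : End A)) ≫ g := by
        change g ^ (k + 1) * h = g * (g ^ k * h)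
        rw [pow_succ', mul_assoc]
      rw [h3, ← Ext.mk₀_comp_mk₀_assoc, h1, Ext.comp_zero]
    change z = 0
    rw [← hθeq (by lia) z]
    change (Ext.mk₀ θ).comp x _ = 0
    rw [h2, Ext.comp_zero]
  obtain ⟨x, rfl⟩ := Ext.contravariant_sequence_exact₃ hS.2 Z y hinj (add_comm 1 j)
  have h4 : ρ = g ≫ (g ^ k : End A) ≫ h := by
    change g ^ (k + 1) * h = h * g ^ k * g
    rw [hc, pow_succ, mul_assoc]
  have h5 : x = (Ext.mk₀ f).comp ((Ext.mk₀ θ).comp ((Ext.mk₀ ((g ^ k : End A) ≫ h)).comp x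
      (zero_add j)) (zero_add j)) (zero_add j) := by
    conv_lhs => rw [← hgh hj x, h4]
    rw [Ext.mk₀_comp_mk₀_assoc, Ext.mk₀_comp_mk₀_assoc]
  rw [h5, ShortComplex.ShortExact.extClass_comp_assoc]

variable [HasProjectiveGenerator C]

/-- The horseshoe lemma trades one iterate for one syzygy, at the cost of replacing `M` by `syz M ⊞
gen C`. -/
lemma exists_bound_of_iterate_eq (n : ℕ) : ∀ M : C, ∃ d : ℕ, ∀ (A B X : C) (f : A ⟶ B) (g : B ⟶ X),
    SES f g → AddGen M A →
      StableClass.syzHom^[n] (StableClass.mk A) = StableClass.syzHom^[n] (StableClass.mk B) →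
      (∃ r, HasProjectiveDimensionLT X r) → HasProjectiveDimensionLT X d := by
  induction n with
  | zero =>
    intro M
    obtain ⟨d, hd⟩ := exists_bound_of_stableIso M
    exact ⟨d, fun A B X f g h hA he => hd A B X f g h hA (StableClass.mk_eq.1 he)⟩
  | succ n ih =>
    intro M
    obtain ⟨d, hd⟩ := ih (syz M ⊞ gen C)
    -- One unit pays for the syzygy; the other keeps the index at least 1 in the dimension shift.
    refine ⟨d + 2, ?_⟩
    rintro A B X f g h hA he ⟨r, hr⟩
    obtain ⟨K, k, l, i, p, hl, hp, -⟩ := horseshoe h (syz_ses A) (syz_ses X)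
    rw [Function.iterate_succ_apply, Function.iterate_succ_apply, StableClass.syzHom_mk,
      StableClass.syzHom_mk, ← StableClass.mk_eq.2 (syz_of_ses hl)] at he
    have hP : Projective (Projective.over X) := inferInstance
    have h1 := hd _ _ _ i p hp hA.syz he ⟨r + 1, ((syz_ses X).2.hasProjectiveDimensionLT_X₃_iff r
      hP).1 (hasProjectiveDimensionLT_of_ge X r (r + 2) (by lia))⟩
    exact ((syz_ses X).2.hasProjectiveDimensionLT_X₃_iff d hP).2
      (hasProjectiveDimensionLT_of_ge _ d (d + 1) (by lia))

/-- The Igusa–Todorov bound: cokernels of monomorphisms in `add M` having finite projective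
dimension have uniformly bounded projective dimension. -/
theorem igusa_todorov_bound (M : C) : ∃ d : ℕ, ∀ (A B X : C) (f : A ⟶ B) (g : B ⟶ X),
    SES f g → AddGen M A → AddGen M B → (∃ r, HasProjectiveDimensionLT X r) →
      HasProjectiveDimensionLT X d := by
  obtain ⟨F, hF, hFM⟩ := StableClass.exists_finite_closure M
  obtain ⟨n, hn⟩ := exists_iterate_bound StableClass.syzHom F hF
  obtain ⟨d, hd⟩ := exists_bound_of_iterate_eq n M
  refine ⟨d, ?_⟩
  rintro A B X f g h hA hB ⟨r, hr⟩
  exact hd A B X f g h hA (hn _ (hFM A hA) _ (hFM B hB) ⟨r, h.stableClass_iterate_eq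
    (hasProjectiveDimensionLT_of_ge X r (r + 1) (by lia))⟩) ⟨r, hr⟩

end IgusaTodorovBound

/-! ### Summands of extensions: lifting idempotents and the uniform bound. -/

section Summands

open Abelian

variable {C : Type u} [Category.{v} C] [Abelian C]

/-- If `0 ⟶ A ⟶ B ⟶ W ⟶ 0` is exact and an idempotent of `W` with image `X` lifts to an idempotent
of `B` with image `B₁`, then `X` is a quotient of `B₁` with kernel a direct summand of `A`. -/
lemma SES.exists_retract {A B W X : C} {a : A ⟶ B} {b : B ⟶ W} (h : SES a b) (r : Retract X W)
    (π : B ⟶ B) (hπ : π ≫ π = π) (hb : π ≫ b = b ≫ r.r ≫ r.i) :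
    ∃ (A₁ B₁ : C) (f : A₁ ⟶ B₁) (g : B₁ ⟶ X), SES f g ∧ Nonempty (Retract A₁ A) ∧
      Nonempty (Retract B₁ B) := by
  have := h.mono
  have := h.epi
  obtain ⟨B₁, q, hq⟩ := exists_retract_of_idempotent π hπ
  let g : B₁ ⟶ X := q.i ≫ b ≫ r.r
  have hg : q.r ≫ g = b ≫ r.r := by
    simp only [g, ← Category.assoc, hq, hb]
    simp
  have : Epi r.r := ⟨fun x y e => by simpa using r.i ≫= e⟩
  have : Epi g := by
    have : Epi (q.r ≫ g) := by
      rw [hg]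
      exact epi_comp _ _
    exact epi_of_epi q.r g
  have hK := SES.ofKernel g
  obtain ⟨s, hs⟩ := h.lift (kernel.ι g ≫ q.i) (by
    have h1 : q.i ≫ b = g ≫ r.i := by
      have : q.i = q.i ≫ π := by simp [← hq]
      rw [this, Category.assoc, hb]
      simp [g]
    rw [Category.assoc, h1, kernel.condition_assoc, zero_comp])
  obtain ⟨t, ht⟩ := hK.lift (a ≫ q.r) (by rw [Category.assoc, hg, reassoc_of% h.w, zero_comp])
  refine ⟨kernel g, B₁, kernel.ι g, g, hK, ⟨⟨s, t, ?_⟩⟩, ⟨q⟩⟩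
  rw [← cancel_mono (kernel.ι g), Category.assoc, ht, reassoc_of% hs]
  simp

/-- An idempotent that lifts along a morphism to some endomorphism lifts to an idempotent. -/
lemma exists_idempotent_lift [HasLength C] {B W : C} (b : B ⟶ W) (e : W ⟶ W) (he : e ≫ e = e)
    (ε : B ⟶ B) (hε : ε ≫ b = b ≫ e) : ∃ π : B ⟶ B, π ≫ π = π ∧ π ≫ b = b ≫ e := by
  obtain ⟨k, h, hc, hk⟩ := fitting_idempotent (X := B) ε
  let γ : B ⟶ B := (show End B from ε) ^ (k + 1)
  have hγ : γ ≫ b = b ≫ e := by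
    have : ∀ n, (show B ⟶ B from (show End B from ε) ^ (n + 1)) ≫ b = b ≫ e := by
      intro n
      induction n with
      | zero => simpa using hε
      | succ n ih =>
        rw [pow_succ]
        change (ε ≫ (show B ⟶ B from (show End B from ε) ^ (n + 1))) ≫ b = b ≫ e
        rw [Category.assoc, ih, reassoc_of% hε, he]
    exact this k
  have h1 : h ≫ γ = γ ≫ h := hc
  have h2 : (h ≫ γ) ≫ γ = γ := hk
  refine ⟨h ≫ γ, ?_, ?_⟩
  · calc (h ≫ γ) ≫ h ≫ γ = h ≫ (γ ≫ h) ≫ γ := by simp only [Category.assoc]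
      _ = h ≫ (h ≫ γ) ≫ γ := by rw [h1]
      _ = h ≫ γ := by rw [h2]
  · -- both sides equal `(h ≫ γ) ≫ b ≫ e`
    have h3 : (h ≫ γ) ≫ b ≫ e = b ≫ e := by rw [← hγ, ← Category.assoc, h2]
    calc (h ≫ γ) ≫ b = h ≫ γ ≫ b := Category.assoc _ _ _
      _ = h ≫ (b ≫ e) ≫ e := by rw [hγ, Category.assoc, he]
      _ = (h ≫ γ) ≫ b ≫ e := by simp only [Category.assoc, reassoc_of% hγ]
      _ = b ≫ e := h3

/-- Rotation: a short exact sequence `U ⟶ W ⟶ V` gives `syz V ⟶ U ⊞ Q ⟶ W` with `Q` projective. -/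
lemma SES.rotate {U W V K Q : C} {i : U ⟶ W} {p : W ⟶ V} (h : SES i p) {c : K ⟶ Q} {d : Q ⟶ V}
    (hV : SES c d) {q : Q ⟶ W} (hq : q ≫ p = d) :
    ∃ f : K ⟶ U ⊞ Q, SES f (biprod.desc i q) := by
  have := h.mono
  have := h.epi
  have := hV.mono
  have := hV.epi
  obtain ⟨x, hx⟩ := h.lift (c ≫ q) (by rw [Category.assoc, hq, hV.w])
  refine ⟨biprod.lift (-x) c, SES.mk' ?_ ?_ (by simp [hx]) ?_⟩
  · have : Mono (biprod.lift (-x) c ≫ biprod.snd) := by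
      rw [biprod.lift_snd]
      infer_instance
    exact mono_of_mono _ biprod.snd
  · refine Preadditive.epi_of_cancel_zero _ fun {Z} y hy => ?_
    have h1 : i ≫ y = 0 := by simpa using biprod.inl ≫= hy
    obtain ⟨y, rfl⟩ := h.desc y h1
    have h2 : d ≫ y = 0 := by simpa [reassoc_of% hq] using biprod.inr ≫= hy
    rw [(cancel_epi d).1 (h2.trans comp_zero.symm), comp_zero]
  · intro Z y hy
    have h0 : (y ≫ biprod.fst) ≫ i + (y ≫ biprod.snd) ≫ q = 0 := by
      rw [← hy, ← biprod.lift_desc]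
      congr 1
      ext <;> simp
    have h1 : (y ≫ biprod.snd) ≫ d = 0 := by
      have := h0 =≫ p
      simp only [Preadditive.add_comp, Category.assoc, h.w, hq, comp_zero, zero_add, zero_comp]
        at this
      simpa using this
    obtain ⟨z, hz⟩ := hV.lift _ h1
    refine ⟨z, ?_⟩
    have h2 : z ≫ x = -(y ≫ biprod.fst) := by
      rw [← cancel_mono i, Category.assoc, hx, reassoc_of% hz, Preadditive.neg_comp,
        eq_neg_iff_add_eq_zero, add_comm]
      simpa using h0
    ext
    · simp [h2]
    · simp [hz]

variable [HasProjectiveGenerator C] [HasLength C] [HasNoetherianEnd C]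

/-- The factorization is what allows the idempotent of `W` to lift along the rotated epimorphism `U
⊞ Q ⟶ W`, reducing to the Igusa–Todorov bound. -/
lemma exists_bound_of_factors (T : C) : ∃ d : ℕ, ∀ (U W V X : C) (i : U ⟶ W) (p : W ⟶ V)
    (r : Retract X W), SES i p → AddGen T U → AddGen T V →
      (∃ n, HasProjectiveDimensionLT X n) →
      (∃ f : U ⟶ Projective.over V, f ≫ Projective.π V = i ≫ (r.r ≫ r.i) ≫ p) →
      HasProjectiveDimensionLT X d := by
  obtain ⟨d, hd⟩ := igusa_todorov_bound ((T ⊞ syz T) ⊞ gen C)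
  refine ⟨d, ?_⟩
  rintro U W V X i p r h hU hV hX ⟨f, hf⟩
  have := h.mono
  have := h.epi
  let e : W ⟶ W := r.r ≫ r.i
  let q : Projective.over V ⟶ W := Projective.factorThru (Projective.π V) p
  have hq : q ≫ p = Projective.π V := by simp [q]
  obtain ⟨j, hj⟩ := h.rotate (syz_ses V) hq
  -- Subtracting `f ≫ q` removes the `V`-component of `i ≫ e`, so `b` and `f` are the coordinates of
  -- a lift of `e` on `U`.
  obtain ⟨b, hb⟩ := h.lift (i ≫ e - f ≫ q) (by
    rw [Preadditive.sub_comp, Category.assoc f, hq, hf]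
    simp [e])
  have := hj.epi
  let l := biprod.desc i q
  let c : Projective.over V ⟶ U ⊞ Projective.over V := Projective.factorThru (q ≫ e) l
  have hc : c ≫ l = q ≫ e := by simp [c, l]
  obtain ⟨π, hπ, hπl⟩ := exists_idempotent_lift l e (by simp [e]) (biprod.desc (biprod.lift b f) c)
    (by
      ext
      · simp [l, hb]
      · simp [l, hc])
  obtain ⟨A, B, x, y, hxy, ⟨rA⟩, ⟨rB⟩⟩ := hj.exists_retract r π hπ hπl
  have hsyz : AddGen ((T ⊞ syz T) ⊞ gen C) (syz V) := by
    refine AddGen.trans ?_ hV.syz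
    exact (((AddGen.self _).inr _).inl _).biprod ((AddGen.self _).inr _)
  refine hd _ _ _ x y hxy (hsyz.of_retract rA) (AddGen.of_retract ?_ rB) hX
  exact ((hU.inl _).inl _).biprod ((AddGen.of_projective _).inr _)

/-- Each syzygy lowers by one the degree from which the map kills Ext; at degree 1 it lifts to the
projective. -/
lemma exists_bound_of_extVanish [HasExt.{w} C] (N : ℕ) : ∀ T : C, ∃ d : ℕ,
    ∀ (U W V X : C) (i : U ⟶ W) (p : W ⟶ V) (r : Retract X W), SES i p → AddGen T U → AddGen T V →
      (∃ n, HasProjectiveDimensionLT X n) → ExtVanish.{v, u, w} (N + 1) (i ≫ (r.r ≫ r.i) ≫ p) →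
      HasProjectiveDimensionLT X d := by
  induction N with
  | zero =>
    intro T
    obtain ⟨d, hd⟩ := exists_bound_of_factors T
    exact ⟨d, fun U W V X i p r h hU hV hX hφ =>
      hd U W V X i p r h hU hV hX (hφ.factors (syz_ses V))⟩
  | succ N ih =>
    intro T
    obtain ⟨d, hd⟩ := ih (syz T ⊞ gen C)
    refine ⟨d + 2, ?_⟩
    rintro U W V X i p r h hU hV ⟨n, hn⟩ hφ
    have hP : Projective (Projective.over X) := inferInstance
    obtain ⟨K, k, l, i', p', hl, hp, hik, hpk, hil, hlp⟩ := horseshoe h (syz_ses U) (syz_ses V)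
    have := hl.mono
    obtain ⟨σ, s', hs, hs'⟩ := (syz_ses X).exists_lift hl r.i
    obtain ⟨τ, t', ht, ht'⟩ := hl.exists_lift (syz_ses X) r.r
    obtain ⟨c, hc⟩ := (syz_ses X).exists_factor (a := syzι X)
      (f' := s' ≫ t' - 𝟙 _) (θ := σ ≫ τ - 𝟙 _)
      (by
        rw [Preadditive.sub_comp, Category.assoc, ht, reassoc_of% hs, Preadditive.comp_sub]
        simp)
      (by
        rw [Preadditive.sub_comp, Category.assoc, ht', reassoc_of% hs', r.retract]
        simp)
    -- The lifted retraction holds only modulo a map through `Projective.over X`, so this projective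
    -- is added to `K`, and below also to `syz U`.
    let r' : Retract (syz X) (K ⊞ Projective.over X) :=
      { i := biprod.lift s' (syzι X)
        r := biprod.desc t' (-c)
        retract := by
          rw [biprod.lift_desc, Preadditive.comp_neg, hc]
          abel }
    have hses : SES (biprod.map i' (𝟙 (Projective.over X))) (biprod.fst ≫ p' :
        K ⊞ Projective.over X ⟶ syz V) := by
      have := hp.mono
      have := hp.epi
      refine SES.mk' inferInstance (epi_comp _ _) (by simp [hp.w]) fun Z x hx => ?_
      obtain ⟨y, hy⟩ := hp.lift (x ≫ biprod.fst) (by simpa using hx)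
      exact ⟨biprod.lift y (x ≫ biprod.snd), by ext <;> simp [hy]⟩
    have hφ' : ExtVanish.{v, u, w} (N + 1)
        (biprod.map i' (𝟙 (Projective.over X)) ≫ (r'.r ≫ r'.i) ≫ biprod.fst ≫ p') := by
      intro j hj Z α
      refine Ext.biprod_ext ?_ ?_
      · rw [Ext.mk₀_comp_mk₀_assoc, Ext.comp_zero]
        have h1 : biprod.inl ≫ biprod.map i' (𝟙 (Projective.over X)) ≫ (r'.r ≫ r'.i) ≫
            biprod.fst ≫ p' = i' ≫ (t' ≫ s') ≫ p' := by simp [r']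
        rw [h1]
        refine ExtVanish.shift (syz_ses U) (syz_ses V) (φ := i ≫ (r.r ≫ r.i) ≫ p)
          (θ := biprod.inl ≫ τ ≫ σ ≫ biprod.snd) ?_ ?_ (by lia) hφ j hj Z α
        · simp only [Category.assoc, hpk, reassoc_of% hs, reassoc_of% ht, reassoc_of% hik]
        · simp only [Category.assoc, ← hlp, reassoc_of% hs', reassoc_of% ht', reassoc_of% hil]
      · rw [Ext.mk₀_comp_mk₀_assoc, Ext.comp_zero]
        exact ExtVanish.of_projective _ j (by lia) Z α
    have h1 := hd _ _ _ _ _ _ r' hses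
      (hU.syz.biprod ((AddGen.of_projective (Projective.over X)).inr _))
      hV.syz ⟨n + 1, ((syz_ses X).2.hasProjectiveDimensionLT_X₃_iff n
        hP).1 (hasProjectiveDimensionLT_of_ge X n (n + 2) (by lia))⟩ hφ'
    exact ((syz_ses X).2.hasProjectiveDimensionLT_X₃_iff d hP).2
      (hasProjectiveDimensionLT_of_ge _ d (d + 1) (by lia))

/-- Direct summands of finite projective dimension of extensions of objects of `add T` by objects of
`add T` have uniformly bounded projective dimension. -/
theorem exists_bound_of_extension (T : C) : ∃ d : ℕ, ∀ (U W V X : C) (i : U ⟶ W) (p : W ⟶ V),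
    Nonempty (Retract X W) → SES i p → AddGen T U → AddGen T V →
      (∃ n, HasProjectiveDimensionLT X n) → HasProjectiveDimensionLT X d := by
  let := HasExt.standard C
  obtain ⟨N, hN⟩ := exists_extVanish_bound.{v, u, max u v} T
  obtain ⟨d, hd⟩ := exists_bound_of_extVanish.{v, u, max u v} N T
  refine ⟨d, ?_⟩
  rintro U W V X i p ⟨r⟩ h hU hV ⟨n, hn⟩
  -- The map `U ⟶ V` factors through `X`, so it kills Ext from degree `n` on, and hence from the
  -- uniform degree `N`.
  refine hd U W V X i p r h hU hV ⟨n, hn⟩ (ExtVanish.mono (hN U V hU hV _ ⟨n, ?_⟩) N.le_succ)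
  have := ExtVanish.of_factor.{v, u, max u v} hn (i ≫ r.r) (r.i ≫ p)
  simpa using this

end Summands

/-! ### Size, minimal syzygies and projective dimension. -/

section Size

attribute [local instance] Abelian.hasFiniteBiproducts

variable {C : Type u} [Category.{v} C] [Abelian C]

lemma addGen_iff_add {T X : C} : AddGen T X ↔ add (fun Y => Y = T) X := by
  constructor
  · rintro ⟨ι, _, s, t, h⟩
    let e := Fintype.equivFin ι
    let r : Retract X (⨁ fun _ : Fin (Fintype.card ι) => T) :=
      { i := biproduct.lift fun j => s (e.symm j)
        r := biproduct.desc fun j => t (e.symm j)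
        retract := by
          rw [biproduct.lift_desc, ← h]
          exact Fintype.sum_equiv e.symm _ _ fun _ => rfl }
    obtain ⟨K, ⟨f⟩, -⟩ := exists_biprod_of_retract r
    exact ⟨_, _, K, fun _ => rfl, ⟨f.symm⟩⟩
  · rintro ⟨k, F, Y, hF, ⟨e⟩⟩
    exact ((AddGen.biproduct fun i => hF i ▸ AddGen.self _).of_iso e).of_retract
      ⟨biprod.inl, biprod.fst, by simp⟩

lemma SES.biproduct {k : ℕ} {U W V : Fin k → C} {i : ∀ j, U j ⟶ W j} {p : ∀ j, W j ⟶ V j}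
    (h : ∀ j, SES (i j) (p j)) : SES (biproduct.map i) (biproduct.map p) := by
  have := fun j => (h j).mono
  have := fun j => (h j).epi
  refine SES.mk' inferInstance inferInstance ?_ ?_
  · ext j
    simp [(h j).w]
  · intro Z x hx
    choose y hy using fun j => (h j).lift (x ≫ biproduct.π _ j) (by
      simpa using hx =≫ biproduct.π _ j)
    exact ⟨biproduct.lift y, by ext j; simp [hy]⟩

/-- `⟨T⟩₂` consists of direct summands of extensions of objects of `add T`. -/
lemma exists_extension_of_extPowerObj_two {T X : C} (h : extPowerObj T 2 X) :
    ∃ (U W V : C) (i : U ⟶ W) (p : W ⟶ V), Nonempty (Retract X W) ∧ SES i p ∧ AddGen T U ∧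
      AddGen T V := by
  obtain ⟨k, F, Y, hF, ⟨e⟩⟩ := h
  choose U V i p w hU hV hS using hF
  have hr : Retract X (X ⊞ Y) := ⟨biprod.inl, biprod.fst, by simp⟩
  exact ⟨_, _, _, _, _, ⟨hr.trans e.retract⟩, SES.biproduct fun j => ⟨w j, hS j⟩,
    AddGen.biproduct fun j => addGen_iff_add.2 (hU j),
    AddGen.biproduct fun j => addGen_iff_add.2 (hV j)⟩

lemma exists_of_size_le_one {𝒳 : ObjectProperty C} (h : size 𝒳 ≤ 1) : ∃ T : C, ∀ X, 𝒳 X →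
    ∃ (U W V : C) (i : U ⟶ W) (p : W ⟶ V), Nonempty (Retract X W) ∧ SES i p ∧ AddGen T U ∧
      AddGen T V := by
  have hlt : size 𝒳 < 2 := h.trans_lt (by norm_num)
  obtain ⟨_, ⟨n, T, rfl, hT⟩, hn⟩ := sInf_lt_iff.1 hlt
  have hn' : n < 2 := by exact_mod_cast hn
  refine ⟨T, fun X hX => ?_⟩
  interval_cases n
  · exact ⟨X, X, 0, 𝟙 X, 0, ⟨Retract.refl X⟩, SES.id_zero X, addGen_iff_add.2 (hT X hX),
      AddGen.of_isZero (isZero_zero C)⟩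
  · exact exists_extension_of_extPowerObj_two (hT X hX)

lemma size_le_rank_of_true (𝒳 : ObjectProperty C) : size 𝒳 ≤ extensionDimension C :=
  sInf_le_sInf fun _ ⟨n, T, hn, h⟩ => ⟨n, T, hn, fun X _ => (h X).1 trivial⟩

lemma finiteProjDim_iff {X : C} : finiteProjDim C X ↔ ∃ n, HasProjectiveDimensionLT X n := by
  rw [finiteProjDim, lt_top_iff_ne_top, projectiveDimension_ne_top_iff]
  exact ⟨fun ⟨n, h⟩ => ⟨n + 1, h⟩, fun ⟨n, h⟩ => ⟨n, hasProjectiveDimensionLT_of_ge X n _ n.le_succ⟩⟩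

lemma IsNthSyzygy.hasProjectiveDimensionLT_iff {n : ℕ} : ∀ {K X : C}, IsNthSyzygy n K X → ∀ d : ℕ,
    HasProjectiveDimensionLT X (d + 1 + n) ↔ HasProjectiveDimensionLT K (d + 1) := by
  induction n with
  | zero =>
    rintro K X ⟨e⟩ d
    exact ⟨fun _ => hasProjectiveDimensionLT_of_iso e.symm _,
      fun _ => hasProjectiveDimensionLT_of_iso e _⟩
  | succ n ih =>
    rintro K X ⟨L, hL, P, i, p, w, hP, -, hS⟩ d
    rw [← hS.hasProjectiveDimensionLT_X₃_iff d hP, ← ih hL (d + 1)]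
    have : d + 1 + (n + 1) = d + 1 + 1 + n := by lia
    rw [this]

lemma size_syzygyClass_le_one [HasProjectiveGenerator C] {d : ℕ}
    (h : ∀ X, finiteProjDim C X → HasProjectiveDimensionLT X (d + 1)) :
    size (syzygyClass d (finiteProjDim C)) ≤ 1 := by
  refine (sInf_le ⟨0, gen C, rfl, ?_⟩ : size _ ≤ ((0 : ℕ) : ℕ∞)).trans (by simp)
  rintro K ⟨M, hM, hK⟩
  have := h M hM
  have h1 : HasProjectiveDimensionLT K (0 + 1) :=
    (hK.hasProjectiveDimensionLT_iff 0).1 (hasProjectiveDimensionLT_of_ge M (d + 1) (0 + 1 + d) (by lia))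
  have : Projective K := projective_iff_hasProjectiveDimensionLT_one.2 h1
  exact addGen_iff_add.1 (AddGen.of_projective K)

variable [HasLength C]

/-- Projective covers exist. -/
lemma exists_isSyzygy [EnoughProjectives C] (X : C) : ∃ K, IsSyzygy K X := by
  classical
  -- An epimorphism from a projective of least length is right minimal: the Fitting summand of `P`
  -- on which `g` is invertible still maps onto `X`.
  have hex : ∃ n, ∃ (P : C) (p : P ⟶ X), Projective P ∧ Epi p ∧ len P = n :=
    ⟨_, Projective.over X, Projective.π X, inferInstance, inferInstance, rfl⟩
  obtain ⟨P, p, hP, hp, hn⟩ := Nat.find_spec hex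
  have hmin : ∀ (Q : C) (q : Q ⟶ X), Projective Q → Epi q → len P ≤ len Q := fun Q q hQ hq =>
    hn ▸ Nat.find_min' hex ⟨Q, q, hQ, hq, rfl⟩
  obtain ⟨w, hS⟩ := SES.ofKernel p
  refine ⟨kernel p, P, kernel.ι p, p, w, hP, fun g hg => ?_, hS⟩
  let e : End P := g
  obtain ⟨k, h, hc, hk⟩ := fitting_idempotent e
  let γ : P ⟶ P := (e ^ (k + 1) : End P)
  have hγ : γ ≫ p = p := by
    have : ∀ n, (e ^ n : End P) ≫ p = p := by
      intro n
      induction n with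
      | zero => exact Category.id_comp p
      | succ n ih =>
        rw [pow_succ]
        change (g ≫ (e ^ n : End P)) ≫ p = p
        rw [Category.assoc, ih, hg]
    exact this _
  have h1 : h ≫ γ = γ ≫ h := hc
  have h2 : (h ≫ γ) ≫ γ = γ := hk
  have h3 : γ ≫ h ≫ γ = γ := by rw [← Category.assoc, ← h1, h2]
  obtain ⟨Q, r, hr⟩ := exists_retract_of_idempotent (h ≫ γ) (by
    calc (h ≫ γ) ≫ h ≫ γ = h ≫ (γ ≫ h ≫ γ) := by simp only [Category.assoc]
      _ = h ≫ γ := by rw [h3])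
  have hQ : Projective Q := r.projective
  have he : Epi (r.i ≫ p) := by
    have h4 : (γ ≫ r.r) ≫ r.i ≫ p = p := by
      calc (γ ≫ r.r) ≫ r.i ≫ p = γ ≫ (r.r ≫ r.i) ≫ p := by simp only [Category.assoc]
        _ = (γ ≫ h ≫ γ) ≫ p := by rw [hr, Category.assoc γ]
        _ = p := by rw [h3, hγ]
    have : Epi ((γ ≫ r.r) ≫ r.i ≫ p) := by
      rw [h4]
      exact hp
    exact epi_of_epi (γ ≫ r.r) (r.i ≫ p)
  have : Epi r.r := ⟨fun a b e => by simpa using r.i ≫= e⟩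
  have : IsIso r.r := isIso_of_epi_of_len r.r (hmin Q _ hQ he)
  have h5 : h ≫ γ = 𝟙 P := by
    rw [← hr, ← cancel_mono r.r]
    simp
  have hu : IsUnit (e ^ (k + 1)) := ⟨⟨_, h, h5, hc.symm.trans h5⟩, rfl⟩
  exact (isUnit_iff_isIso e).1 ((isUnit_pow_iff (Nat.succ_ne_zero k)).1 hu)

lemma exists_isNthSyzygy [EnoughProjectives C] (n : ℕ) (X : C) : ∃ K, IsNthSyzygy n K X := by
  induction n with
  | zero => exact ⟨X, ⟨Iso.refl X⟩⟩
  | succ n ih =>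
    obtain ⟨L, hL⟩ := ih
    obtain ⟨K, hK⟩ := exists_isSyzygy L
    exact ⟨K, L, hL, hK⟩

/-- The bound for summands of extensions applies to the `n`-th syzygy, and shifting back adds `n`.
-/
lemma exists_bound_of_size_le_one [HasProjectiveGenerator C] [HasNoetherianEnd C] {n : ℕ}
    (h : size (syzygyClass n (finiteProjDim C)) ≤ 1) :
    ∃ d : ℕ, ∀ X, finiteProjDim C X → HasProjectiveDimensionLT X (d + 1) := by
  obtain ⟨T, hT⟩ := exists_of_size_le_one h
  obtain ⟨d, hd⟩ := exists_bound_of_extension T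
  refine ⟨d + n, fun X hX => ?_⟩
  obtain ⟨K, hK⟩ := exists_isNthSyzygy n X
  obtain ⟨U, W, V, i, p, hr, hS, hU, hV⟩ := hT K ⟨X, hX, hK⟩
  obtain ⟨m, hm⟩ := finiteProjDim_iff.1 hX
  have h1 := hd U W V K i p hr hS hU hV ⟨m + 1,
    (hK.hasProjectiveDimensionLT_iff m).1 (hasProjectiveDimensionLT_of_ge X m _ (by lia))⟩
  have h2 := (hK.hasProjectiveDimensionLT_iff d).2 (hasProjectiveDimensionLT_of_ge K d _ (by lia))
  exact hasProjectiveDimensionLT_of_ge X (d + 1 + n) (d + n + 1) (by lia)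

end Size

/-! ### Finitely generated modules: length, projective generator, Hom modules. -/

section FGModule

variable {A : Type u} [Ring A]

lemma FGModuleCat.isZero_of_subsingleton (X : FGModuleCat.{u} A) [Subsingleton X] : IsZero X :=
  (IsZero.iff_id_eq_zero X).2 <| FGModuleCat.hom_ext <| LinearMap.ext fun _ =>
    Subsingleton.elim (α := X) _ _

/-- Evaluation at `n` generators of `M` embeds the maps `R`-linearly in `N ^ n`. -/
lemma isNoetherian_linearMap (R M N : Type*) [CommRing R] [Algebra R A] [AddCommGroup M]
    [AddCommGroup N] [Module A M] [Module A N] [Module R N] [IsScalarTower R A N]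
    [Module.Finite A M] [IsNoetherian R N] : IsNoetherian R (M →ₗ[A] N) := by
  obtain ⟨n, f, hf⟩ := Module.Finite.exists_fin' A M
  let φ : (M →ₗ[A] N) →ₗ[R] (Fin n → N) :=
    { toFun g i := g (f (Pi.single i 1))
      map_add' _ _ := rfl
      map_smul' _ _ := rfl }
  refine isNoetherian_of_injective φ fun g g' h => ?_
  rw [← LinearMap.cancel_right hf]
  exact LinearMap.pi_ext' fun i => LinearMap.ext_ring (congrFun h i)

variable [IsNoetherianRing A]

lemma FGModuleCat.surjective_of_epi {X Y : FGModuleCat.{u} A} (f : X ⟶ Y) [Epi f] :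
    Function.Surjective f.hom.hom :=
  (ModuleCat.epi_iff_surjective _).1
    (inferInstanceAs (Epi ((forget₂ (FGModuleCat.{u} A) (ModuleCat.{u} A)).map f)))

lemma FGModuleCat.epi_of_surjective {X Y : FGModuleCat.{u} A} (f : X ⟶ Y)
    (hf : Function.Surjective f.hom.hom) : Epi f :=
  (forget₂ (FGModuleCat.{u} A) (ModuleCat.{u} A)).epi_of_epi_map
    ((ModuleCat.epi_iff_surjective _).2 hf)

lemma SES.length_eq {X Y Z : FGModuleCat.{u} A} {f : X ⟶ Y} {g : Y ⟶ Z} (h : SES f g) :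
    Module.length A Y = Module.length A X + Module.length A Z := by
  obtain ⟨w, h⟩ := h
  have h' := h.map_of_exact (forget₂ (FGModuleCat.{u} A) (ModuleCat.{u} A))
  exact Module.length_eq_add_of_exact f.hom.hom g.hom.hom h'.moduleCat_injective_f
    h'.moduleCat_surjective_g ((ShortComplex.ShortExact.moduleCat_exact_iff_function_exact _).1
      h'.exact)

instance hasLength_fgModuleCat [IsArtinianRing A] : HasLength (FGModuleCat.{u} A) where
  exists_length := by
    refine ⟨fun X => (Module.length A X).toNat, fun f g h => ?_, fun X hX => ?_⟩
    · dsimp only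
      rw [h.length_eq, ENat.toNat_add Module.length_ne_top Module.length_ne_top]
    · have := (ENat.toNat_eq_zero.1 hX).resolve_right Module.length_ne_top
      have : Subsingleton X := Module.length_eq_zero_iff.1 this
      exact FGModuleCat.isZero_of_subsingleton X

instance FGModuleCat.projective_of_self : Projective (FGModuleCat.of A A) where
  factors {E X} f e _ := by
    obtain ⟨φ, hφ⟩ := Module.projective_lifting_property e.hom.hom f.hom.hom
      (FGModuleCat.surjective_of_epi e)
    exact ⟨FGModuleCat.ofHom φ, FGModuleCat.hom_ext hφ⟩

lemma FGModuleCat.addGen_fin_fun (n : ℕ) :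
    AddGen (FGModuleCat.of A A) (FGModuleCat.of A (Fin n → A)) := by
  refine ⟨Fin n, inferInstance, fun i => FGModuleCat.ofHom (LinearMap.proj i),
    fun i => FGModuleCat.ofHom (LinearMap.single A (fun _ => A) i), ?_⟩
  let F := forget₂ (FGModuleCat.{u} A) (ModuleCat.{u} A)
  have : F.Additive := ⟨rfl⟩
  refine F.map_injective ?_
  rw [F.map_sum]
  refine ModuleCat.hom_ext (LinearMap.ext fun x => ?_)
  rw [ModuleCat.hom_sum, LinearMap.sum_apply]
  exact Finset.univ_sum_single x

instance hasProjectiveGenerator_fgModuleCat : HasProjectiveGenerator (FGModuleCat.{u} A) where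
  exists_generator := by
    refine ⟨FGModuleCat.of A A, inferInstance, fun X => ?_⟩
    obtain ⟨n, f, hf⟩ := Module.Finite.exists_fin' A X
    exact ⟨FGModuleCat.of A (Fin n → A), FGModuleCat.ofHom f,
      FGModuleCat.epi_of_surjective _ hf, FGModuleCat.addGen_fin_fun n⟩

end FGModule

/-! ### Artin algebras and the finitistic dimension. -/

section ArtinAlgebra

variable (Λ : Type u) [Ring Λ] [hΛ : IsArtinAlgebra Λ]

instance IsArtinAlgebra.isArtinianRing_op : IsArtinianRing Λᵐᵒᵖ := by
  obtain ⟨R, _, _, _, _⟩ := hΛ.exists_base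
  have : Module.Finite R Λᵐᵒᵖ := Module.Finite.equiv (MulOpposite.opLinearEquiv R (M := Λ))
  exact isArtinian_of_tower R (inferInstance : IsArtinian R Λᵐᵒᵖ)

instance hasNoetherianEnd_rMod : HasNoetherianEnd (RMod Λ) where
  isNoetherianRing_end X := by
    obtain ⟨R, _, _, _, _⟩ := hΛ.exists_base
    have : Module.Finite R Λᵐᵒᵖ := Module.Finite.equiv (MulOpposite.opLinearEquiv R (M := Λ))
    let _ : Module R X := Module.compHom X (algebraMap R Λᵐᵒᵖ)
    have : IsScalarTower R Λᵐᵒᵖ X := .of_algebraMap_smul fun _ _ => rfl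
    have : Module.Finite R X := Module.Finite.trans Λᵐᵒᵖ X
    have : IsNoetherian R (Module.End Λᵐᵒᵖ X) := isNoetherian_linearMap R X X
    have : IsNoetherianRing (Module.End Λᵐᵒᵖ X) := isNoetherian_of_tower R this
    let e : Module.End Λᵐᵒᵖ X ≃+* End X :=
      { toFun f := FGModuleCat.ofHom f
        invFun f := InducedCategory.Hom.hom f |>.hom
        left_inv _ := rfl
        right_inv _ := rfl
        map_mul' _ _ := rfl
        map_add' _ _ := rfl }
    exact isNoetherianRing_of_ringEquiv _ e

lemma findim_lt_top_iff : findim Λ < ⊤ ↔ ∃ d : ℕ, ∀ X : RMod Λ, finiteProjDim (RMod Λ) X →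
    HasProjectiveDimensionLT X (d + 1) := by
  constructor
  · intro h
    obtain ⟨d, hd⟩ : ∃ d : ℕ, findim Λ ≤ d := by
      generalize findim Λ = a at h
      cases a with
      | bot => exact ⟨0, bot_le⟩
      | coe a =>
        cases a with
        | top => exact absurd h (lt_irrefl _)
        | coe n => exact ⟨n, le_rfl⟩
    refine ⟨d, fun X hX => ?_⟩
    have : projectiveDimension X ≤ d := by
      refine le_trans ?_ hd
      exact le_sSup ⟨X, hX, rfl⟩
    exact (projectiveDimension_le_iff X d).1 this
  · rintro ⟨d, hd⟩
    have : findim Λ ≤ d := sSup_le (by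
      rintro _ ⟨X, hX, rfl⟩
      exact (projectiveDimension_le_iff X d).2 (hd X hX))
    exact this.trans_lt (WithBot.coe_lt_coe.2 (ENat.natCast_lt_top d))

end ArtinAlgebra

end ExtDim

theorem proposition3p11 (Λ : Type u) [Ring Λ] [ExtDim.IsArtinAlgebra Λ] :
    (ExtDim.findim Λ < ⊤ ↔
      ∃ n : ℕ, ExtDim.size
        (ExtDim.syzygyClass n (ExtDim.finiteProjDim (ExtDim.RMod Λ))) ≤ 1) ∧
    (ExtDim.extensionDimension (ExtDim.RMod Λ) ≤ 1 → ExtDim.findim Λ < ⊤) := by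
  rw [ExtDim.findim_lt_top_iff]
  exact ⟨⟨fun ⟨d, hd⟩ => ⟨d, ExtDim.size_syzygyClass_le_one hd⟩,
      fun ⟨n, hn⟩ => ExtDim.exists_bound_of_size_le_one hn⟩,
    fun h => ExtDim.exists_bound_of_size_le_one (n := 0)
      ((ExtDim.size_le_rank_of_true _).trans h)⟩
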